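/- Let $A$ be a real $l\times m$ matrix and $B$ a real $m\times n$ matrix with $AB\neq 0$. For a nonzero real vector $v$ and a nonzero real matrix $M$ write $|v\rangle=\|v\|_2^{-1}\sum_k v_k|k\rangle$ and $|M\rangle=\|M\|_F^{-1}\sum_{i,j}M_{ij}|i,j\rangle$, where indices are stored in binary and $\|\cdot\|_F$ is the Frobenius norm. Suppose that unitaries preparing the rows of $A$ and the columns of $B$ are available as black boxes, i.e. unitaries that map, for every nonzero row $A_{i\bullet}$ and every nonzero column $B_{\bullet j}$, $$|i\rangle|0\rangle\mapsto|i\rangle|A_{i\bullet}\rangle,\qquad |j\rangle|0\rangle\mapsto|j\rangle|B_{\bullet j}\rangle,\qquad |0\rangle\mapsto\frac1{\|A\|_F}\sum_i\|A_{i\bullet}\|_2|i\rangle,\qquad |0\rangle\mapsto\frac1{\|B\|_F}\sum_j\|B_{\bullet j}\|_2|j\rangle .$$ Then the quantum state $|AB\rangle$ can be obtained to accuracy $\epsilon$ in time $\widetilde O\big(\|A\|_F^3\|B\|_F^3/(\|AB\|_F^3\,\epsilon)\big)$. Precisely: there are constants $K,c\in\mathbb N$ such that for all $l,m,n\in\mathbb{N}$,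 all $\epsilon>0$ and all $R\ge 1$ there is a quantum circuit, built from gates on at most two qubits and (possibly controlled) queries to the four unitaries and their inverses, with at most $$K\,\frac{R^3}{\epsilon}\,\log^c\!\Big(2+\frac{lmnR}{\epsilon}\Big)$$ gates and queries in total, such that for all $A,B$ as above with $\|A\|_F\|B\|_F/\|AB\|_F\le R$, and for all unitaries as above, the circuit run on $|0\cdots0\rangle$ ends in a state within Euclidean distance $\epsilon$ of $|AB\rangle\otimes|\chi\rangle$ for some normalized state $|\chi\rangle$ of the work qubits. (In particular one may take $R=\|A\|_F\|B\|_F/\|AB\|_F$.) -/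

import Mathlib

open scoped Matrix Matrix.Norms.Frobenius

noncomputable section

namespace QMatMul

/-! ## Qubit registers -/

/-- A (not necessarily normalised) state vector of `N` qubits, given by its amplitudes in the
computational basis, which is indexed by bit strings. -/
abbrev State (N : ℕ) : Type := (Fin N → Bool) → ℂ

/-- The Euclidean (`ℓ²`) norm of a state vector. -/
def State.norm {N : ℕ} (ψ : State N) : ℝ := ‖WithLp.toLp 2 ψ‖

/-- The computational basis state `|x⟩`. -/
def ket {N : ℕ} (x : Fin N → Bool) : State N := Pi.single x 1

/-- The all-zero basis state `|0…0⟩`. -/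
def ketZero (N : ℕ) : State N := ket (fun _ => false)

/-- The tensor product of an `a`-qubit state and a `b`-qubit state (the first `a` qubits carry
`ψ`, the last `b` qubits carry `φ`). -/
def tensor {a b : ℕ} (ψ : State a) (φ : State b) : State (a + b) :=
  fun x => ψ (fun i => x (Fin.castAdd b i)) * φ (fun j => x (Fin.natAdd a j))

/-- The number `⌈log₂ d⌉` of qubits of a register that holds an index `k < d`. -/
abbrev qubits (d : ℕ) : ℕ := Nat.clog 2 d

/-- The basis state `|k⟩` of the register for indices `k < d`, in binary. -/
def idx {d : ℕ} (k : Fin d) : State (qubits d) := ket (fun t => Nat.testBit k.val t.val)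

/-- The Euclidean norm of a real vector. -/
def vecNorm {d : ℕ} (v : Fin d → ℝ) : ℝ := ‖WithLp.toLp 2 v‖

/-- The quantum state `|v⟩ = ‖v‖₂⁻¹ ∑ₖ vₖ |k⟩` of a (nonzero) real vector. -/
def vecState {d : ℕ} (v : Fin d → ℝ) : State (qubits d) :=
  ∑ k, ((v k / vecNorm v : ℝ) : ℂ) • idx k

/-- The quantum state `|M⟩ = ‖M‖_F⁻¹ ∑ᵢⱼ Mᵢⱼ |i, j⟩` of a (nonzero) real matrix; `‖M‖` is the
Frobenius norm. -/
def matState {l n : ℕ} (M : Matrix (Fin l) (Fin n) ℝ) : State (qubits l + qubits n) :=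
  ∑ i, ∑ j, ((M i j / ‖M‖ : ℝ) : ℂ) • tensor (idx i) (idx j)

/-- The vector of the Euclidean norms of the rows of `M`. -/
def rowNorms {l n : ℕ} (M : Matrix (Fin l) (Fin n) ℝ) : Fin l → ℝ := fun i => vecNorm (M i)

/-- The vector of the Euclidean norms of the columns of `M`. -/
def colNorms {l n : ℕ} (M : Matrix (Fin l) (Fin n) ℝ) : Fin n → ℝ := rowNorms Mᵀ

/-! ## The input: state preparation unitaries for the rows of `A` and the columns of `B` -/

/-- The names of the four state preparation unitaries. -/
inductive Oracle
  /-- `|i⟩|0⟩ ↦ |i⟩|Aᵢ⟩`, where `Aᵢ` is the `i`-th row of `A` -/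
  | rowA
  /-- `|0⟩ ↦` the state of the vector of row norms of `A` -/
  | normA
  /-- `|j⟩|0⟩ ↦ |j⟩|Bⱼ⟩`, where `Bⱼ` is the `j`-th column of `B` -/
  | colB
  /-- `|0⟩ ↦` the state of the vector of column norms of `B` -/
  | normB

/-- The number of qubits each oracle acts on, when `A` is `l × m` and `B` is `m × n`. -/
abbrev Oracle.width (l m n : ℕ) : Oracle → ℕ
  | .rowA => qubits l + qubits m
  | .normA => qubits l
  | .colB => qubits n + qubits m
  | .normB => qubits n

/-- A unitary for each of the four oracle names. -/
abbrev OracleFamily (l m n : ℕ) : Type :=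
  (o : Oracle) → Matrix.unitaryGroup (Fin (o.width l m n) → Bool) ℂ

/-- The unitaries `O` prepare the data of `A` and `B`. Nothing is required on the indices of zero
rows or columns (which have no normalised state), on the padding indices, or on inputs whose data
register is not `|0⟩`. -/
structure Prepares {l m n : ℕ} (O : OracleFamily l m n)
    (A : Matrix (Fin l) (Fin m) ℝ) (B : Matrix (Fin m) (Fin n) ℝ) : Prop where
  rowA : ∀ i, A i ≠ 0 →
    (O .rowA).val *ᵥ (tensor (idx i) (ketZero (qubits m)) : State (qubits l + qubits m))
      = tensor (idx i) (vecState (A i))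
  normA : (O .normA).val *ᵥ (ketZero (qubits l) : State (qubits l)) = vecState (rowNorms A)
  colB : ∀ j, Bᵀ j ≠ 0 →
    (O .colB).val *ᵥ (tensor (idx j) (ketZero (qubits m)) : State (qubits n + qubits m))
      = tensor (idx j) (vecState (Bᵀ j))
  normB : (O .normB).val *ᵥ (ketZero (qubits n) : State (qubits n)) = vecState (colNorms B)

/-! ## Quantum circuits with oracle queries -/

/-- The operator `U` on `k` qubits, applied to the qubits `e 0, …, e (k - 1)` of `N` qubits and
extended by the identity on the others. -/
def onQubits {k N : ℕ} (e : Fin k ↪ Fin N) (U : Matrix (Fin k → Bool) (Fin k → Bool) ℂ) :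
    Matrix (Fin N → Bool) (Fin N → Bool) ℂ :=
  Matrix.of fun x y =>
    if ∀ q, (∀ t, e t ≠ q) → x q = y q then U (x ∘ e) (y ∘ e) else 0

/-- The operator `U` controlled by an additional first qubit. -/
def controlled {k : ℕ} (U : Matrix (Fin k → Bool) (Fin k → Bool) ℂ) :
    Matrix (Fin (k + 1) → Bool) (Fin (k + 1) → Bool) ℂ :=
  Matrix.of fun x y =>
    if x 0 = y 0 then
      (if x 0 = true then U (Fin.tail x) (Fin.tail y)
        else (1 : Matrix (Fin k → Bool) (Fin k → Bool) ℂ) (Fin.tail x) (Fin.tail y))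
    else 0

/-- One elementary operation of a circuit on `N` qubits: an arbitrary gate on at most two qubits,
or a query to one of the oracles or to its inverse, plain or controlled by one qubit. -/
inductive Op (l m n N : ℕ)
  | gate (k : ℕ) (hk : k ≤ 2) (e : Fin k ↪ Fin N) (g : Matrix.unitaryGroup (Fin k → Bool) ℂ)
  | query (o : Oracle) (inverse : Bool) (e : Fin (o.width l m n) ↪ Fin N)
  | cquery (o : Oracle) (inverse : Bool) (e : Fin (o.width l m n + 1) ↪ Fin N)

/-- The matrix of an oracle, or of its inverse. -/
def oracleMatrix {l m n : ℕ} (O : OracleFamily l m n) (o : Oracle) (inverse : Bool) :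
    Matrix (Fin (o.width l m n) → Bool) (Fin (o.width l m n) → Bool) ℂ :=
  if inverse = true then ((O o)⁻¹).val else (O o).val

/-- The operator on `N` qubits that an elementary operation performs. -/
def Op.toMatrix {l m n N : ℕ} (O : OracleFamily l m n) :
    Op l m n N → Matrix (Fin N → Bool) (Fin N → Bool) ℂ
  | .gate _ _ e g => onQubits e g.val
  | .query o inverse e => onQubits e (oracleMatrix O o inverse)
  | .cquery o inverse e => onQubits e (controlled (oracleMatrix O o inverse))

/-- A circuit is a finite sequence of elementary operations; it does not refer to the unitaries
that answer its queries. -/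
abbrev Circuit (l m n N : ℕ) : Type := List (Op l m n N)

/-- The running time of a circuit: each gate and each query takes one step. -/
def Circuit.time {l m n N : ℕ} (Q : Circuit l m n N) : ℕ := List.length Q

/-- The final state of a circuit that is run on `|0…0⟩`, with the first operation of the list
applied first. -/
def Circuit.run {l m n N : ℕ} (Q : Circuit l m n N) (O : OracleFamily l m n) : State N :=
  List.foldl (fun ψ op => op.toMatrix O *ᵥ ψ) (ketZero N) Q

/-- The circuit, which has `w` work qubits after its `a` output qubits, obtains the state `φ` to
accuracy `ε` in its output register: its final state is within `ε` of `φ ⊗ χ` for a normalised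
state `χ` of the work qubits. -/
def Circuit.Obtains {l m n a w : ℕ} (Q : Circuit l m n (a + w)) (O : OracleFamily l m n)
    (φ : State a) (ε : ℝ) : Prop :=
  ∃ χ : State w, State.norm χ = 1 ∧ State.norm (Q.run O - tensor φ χ) ≤ ε

end QMatMul

end

noncomputable section

namespace QMatMul

/-! ## Operators on a subset of the qubits -/

/-! The entries of `A * B` are inner products of rows of `A` with columns of `B`, and a single query
to the inverse of `colB` reads off such inner products in superposition. Starting from ∑ᵢⱼ ‖Aᵢ‖‖Bⱼ‖
|i⟩|j⟩|Aᵢ⟩ up to normalization, the inverse of `colB` is applied to a copy of j and the register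
holding |Aᵢ⟩, and then the copy is erased. The basis state |i,j⟩ with all work qubits zero now has
amplitude (AB)ᵢⱼ/(‖A‖‖B‖), so the part with zero work qubits is s|AB⟩, where s = ‖AB‖/(‖A‖‖B‖) ≥ 1/R
(`productCircuit_mulVec_append`). The copy protects j: `colB` is unconstrained on zero columns and
could otherwise move amplitude between columns.

The circuit may not depend on s, so s² is amplified by the π/3 fixed-point recursion W ↦ W Rs W† Rt
W, where Rs and Rt multiply the initial and the target subspace by ω = exp(iπ/3). As ω² = ω - 1, one
step cubes the weight δ = 1 - s² outside the target and only rescales the target part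
(`amplification_step`, `exists_amplify_mulVec`). After k steps the failure weight is δ^(3^k), and
3^k ≥ 3R²/ε makes it at most ε²/2 (`two_mul_one_sub_sq_pow_le`). A small failure weight means
closeness to |AB⟩ ⊗ χ with χ a phase times |0⟩ (`exists_norm_sub_tensor_le`).

The length is O(3^k) times the length of one round, which is linear in the number of qubits. The
reflections are built from two-qubit gates by a chain of reversible ORs into ancillas
(`orGate_mulVec`, `exists_zeroPhase_mulVec`). Their phases are known only when the ancillas are
zero, so the amplification is carried out on states supported there. -/

lemma extend_comp_emb {k N : ℕ} (e : Fin k ↪ Fin N) (z : Fin k → Bool) (x : Fin N → Bool) :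
    Function.extend e z x ∘ e = z := by
  funext t
  exact e.injective.extend_apply z x t

lemma extend_of_avoid {k N : ℕ} (e : Fin k ↪ Fin N) (z : Fin k → Bool) (x : Fin N → Bool)
    {q : Fin N} (h : ∀ t, e t ≠ q) : Function.extend e z x q = x q :=
  Function.extend_apply' _ _ _ (by rintro ⟨t, ht⟩; exact h t ht)

lemma extend_eq_of_agree {k N : ℕ} (e : Fin k ↪ Fin N) (x y : Fin N → Bool)
    (h : ∀ q, (∀ t, e t ≠ q) → x q = y q) : Function.extend e (y ∘ e) x = y := by
  funext q
  by_cases hq : ∃ t, e t = q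
  · obtain ⟨t, rfl⟩ := hq
    exact e.injective.extend_apply _ _ t
  · push Not at hq
    rw [extend_of_avoid e _ _ hq, h q hq]

lemma extend_extend_emb {k N : ℕ} (e : Fin k ↪ Fin N) (z w : Fin k → Bool) (x : Fin N → Bool) :
    Function.extend e w (Function.extend e z x) = Function.extend e w x := by
  funext q
  by_cases hq : ∃ t, e t = q
  · obtain ⟨t, rfl⟩ := hq
    rw [e.injective.extend_apply, e.injective.extend_apply]
  · push Not at hq
    rw [extend_of_avoid e _ _ hq, extend_of_avoid e _ _ hq, extend_of_avoid e _ _ hq]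

/-- The basis states that agree with `x` off the range of `e` are exactly the `Function.extend e z
x`, each for one `z`. Later computations of gate actions start from this formula. -/
lemma onQubits_mulVec {k N : ℕ} (e : Fin k ↪ Fin N)
    (U : Matrix (Fin k → Bool) (Fin k → Bool) ℂ) (ψ : State N) (x : Fin N → Bool) :
    (onQubits e U *ᵥ ψ) x = ∑ z, U (x ∘ e) z * ψ (Function.extend e z x) := by
  symm
  refine Fintype.sum_of_injective (fun z => Function.extend e z x) ?_ _ _ ?_ ?_
  · intro z w h
    have := congrArg (fun y => y ∘ e) h
    simpa only [extend_comp_emb] using this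
  · intro y hy
    change onQubits e U x y * ψ y = 0
    rw [onQubits, Matrix.of_apply, if_neg, zero_mul]
    intro h
    exact hy ⟨y ∘ e, extend_eq_of_agree e x y h⟩
  · intro z
    change _ = onQubits e U x _ * ψ _
    rw [onQubits, Matrix.of_apply, if_pos, extend_comp_emb]
    intro q hq
    rw [extend_of_avoid e _ _ hq]

lemma onQubits_mul {k N : ℕ} (e : Fin k ↪ Fin N)
    (U V : Matrix (Fin k → Bool) (Fin k → Bool) ℂ) :
    onQubits e (U * V) = onQubits e U * onQubits e V := by
  refine Matrix.ext_of_mulVec_single fun y => ?_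
  generalize (Pi.single y 1 : State N) = ψ
  rw [← Matrix.mulVec_mulVec]
  funext x
  simp only [onQubits_mulVec, extend_comp_emb, extend_extend_emb, Matrix.mul_apply,
    Finset.sum_mul, Finset.mul_sum]
  rw [Finset.sum_comm]
  simp only [mul_assoc]

lemma onQubits_one {k N : ℕ} (e : Fin k ↪ Fin N) :
    onQubits e (1 : Matrix (Fin k → Bool) (Fin k → Bool) ℂ) = 1 := by
  refine Matrix.ext_of_mulVec_single fun y => ?_
  generalize (Pi.single y 1 : State N) = ψ
  funext x
  simp only [onQubits_mulVec, Matrix.one_mulVec, Matrix.one_apply, ite_mul, one_mul, zero_mul,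
    Finset.sum_ite_eq, Finset.mem_univ, if_true]
  rw [extend_eq_of_agree e x x fun _ _ => rfl]

lemma onQubits_conjTranspose {k N : ℕ} (e : Fin k ↪ Fin N)
    (U : Matrix (Fin k → Bool) (Fin k → Bool) ℂ) :
    (onQubits e U)ᴴ = onQubits e Uᴴ := by
  ext x y
  simp only [onQubits, Matrix.conjTranspose_apply, Matrix.of_apply]
  by_cases h : ∀ q, (∀ t, e t ≠ q) → x q = y q
  · rw [if_pos h, if_pos fun q hq => (h q hq).symm]
  · rw [if_neg h, if_neg fun h' => h fun q hq => (h' q hq).symm, star_zero]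

lemma onQubits_mem_unitaryGroup {k N : ℕ} (e : Fin k ↪ Fin N)
    {U : Matrix (Fin k → Bool) (Fin k → Bool) ℂ} (hU : U ∈ Matrix.unitaryGroup (Fin k → Bool) ℂ) :
    onQubits e U ∈ Matrix.unitaryGroup (Fin N → Bool) ℂ := by
  rw [Matrix.mem_unitaryGroup_iff] at hU ⊢
  rw [Matrix.star_eq_conjTranspose] at hU ⊢
  rw [onQubits_conjTranspose, ← onQubits_mul, hU, onQubits_one]

/-- An operator on the qubits `e` only changes the factor of a product that lives on `e`. -/
lemma onQubits_mulVec_product {k N : ℕ} (e : Fin k ↪ Fin N)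
    (U : Matrix (Fin k → Bool) (Fin k → Bool) ℂ) (F : State k) (G : State N)
    (hG : ∀ z x, G (Function.extend e z x) = G x) :
    onQubits e U *ᵥ (fun x => F (x ∘ e) * G x) = fun x => (U *ᵥ F) (x ∘ e) * G x := by
  funext x
  simp only [onQubits_mulVec, extend_comp_emb, hG]
  simp only [Matrix.mulVec, dotProduct, Finset.sum_mul, mul_assoc]

/-! ## Controlled operators -/

lemma tail_head_bijective (k : ℕ) :
    Function.Bijective fun x : Fin (k + 1) → Bool => (Fin.tail x, x 0) := by
  constructor
  · intro x y h
    simp only [Prod.mk.injEq] at h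
    rw [← Fin.cons_self_tail x, ← Fin.cons_self_tail y, h.1, h.2]
  · rintro ⟨y, b⟩
    exact ⟨Fin.cons b y, by simp⟩

/-- Splitting off the control bit makes the operator block diagonal with blocks `1` and `U`, which
reduces adjoints and unitarity to those of block diagonal matrices. -/
lemma controlled_eq_submatrix {k : ℕ} (U : Matrix (Fin k → Bool) (Fin k → Bool) ℂ) :
    controlled U = (Matrix.blockDiagonal fun b : Bool => if b = true then U else 1).submatrix
      (Equiv.ofBijective _ (tail_head_bijective k))
      (Equiv.ofBijective _ (tail_head_bijective k)) := by
  ext x y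
  simp only [controlled, Matrix.of_apply, Matrix.submatrix_apply, Equiv.ofBijective_apply,
    Matrix.blockDiagonal_apply]
  split_ifs <;> rfl

lemma controlled_conjTranspose {k : ℕ} (U : Matrix (Fin k → Bool) (Fin k → Bool) ℂ) :
    (controlled U)ᴴ = controlled Uᴴ := by
  rw [controlled_eq_submatrix, controlled_eq_submatrix, Matrix.conjTranspose_submatrix,
    Matrix.blockDiagonal_conjTranspose]
  congr 2
  funext b
  cases b <;> simp

lemma controlled_mem_unitaryGroup {k : ℕ} {U : Matrix (Fin k → Bool) (Fin k → Bool) ℂ}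
    (hU : U ∈ Matrix.unitaryGroup (Fin k → Bool) ℂ) :
    controlled U ∈ Matrix.unitaryGroup (Fin (k + 1) → Bool) ℂ := by
  rw [Matrix.mem_unitaryGroup_iff] at hU ⊢
  rw [Matrix.star_eq_conjTranspose] at hU ⊢
  rw [controlled_conjTranspose, controlled_eq_submatrix, controlled_eq_submatrix,
    Matrix.submatrix_mul_equiv, ← Matrix.blockDiagonal_mul]
  rw [show (fun b : Bool => (if b = true then U else 1) * (if b = true then Uᴴ else 1)) = 1 from
    funext fun b => by cases b <;> simp [hU]]
  rw [Matrix.blockDiagonal_one, Matrix.submatrix_one_equiv]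

/-! ## The operator of a circuit, and the inverse circuit -/

/-- The operator that a circuit performs. -/
def Circuit.mat {l m n N : ℕ} (O : OracleFamily l m n) :
    Circuit l m n N → Matrix (Fin N → Bool) (Fin N → Bool) ℂ
  | [] => 1
  | op :: Q => Circuit.mat O Q * op.toMatrix O

lemma Circuit.mat_append {l m n N : ℕ} (O : OracleFamily l m n) (Q Q' : Circuit l m n N) :
    Circuit.mat O (Q ++ Q' : List _) = Circuit.mat O Q' * Circuit.mat O Q := by
  induction Q with
  | nil => simp [Circuit.mat]
  | cons op Q ih =>
    rw [List.cons_append, Circuit.mat, ih, Circuit.mat, Matrix.mul_assoc]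

lemma Circuit.run_eq {l m n N : ℕ} (O : OracleFamily l m n) (Q : Circuit l m n N) :
    Q.run O = Circuit.mat O Q *ᵥ ketZero N := by
  rw [Circuit.run]
  generalize ketZero N = ψ
  induction Q generalizing ψ with
  | nil => simp [Circuit.mat]
  | cons op Q ih => rw [List.foldl_cons, ih, Circuit.mat, Matrix.mulVec_mulVec]

/-- The inverse of an elementary operation. -/
def Op.inv {l m n N : ℕ} : Op l m n N → Op l m n N
  | .gate k hk e g => .gate k hk e g⁻¹
  | .query o i e => .query o (!i) e
  | .cquery o i e => .cquery o (!i) e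

/-- The inverse circuit. -/
def Circuit.inv {l m n N : ℕ} (Q : Circuit l m n N) : Circuit l m n N := (List.map Op.inv Q).reverse

lemma oracleMatrix_not {l m n : ℕ} (O : OracleFamily l m n) (o : Oracle) (i : Bool) :
    oracleMatrix O o (!i) = (oracleMatrix O o i)ᴴ := by
  cases i <;> simp [oracleMatrix, Matrix.star_eq_conjTranspose]

lemma oracleMatrix_mem_unitaryGroup {l m n : ℕ} (O : OracleFamily l m n) (o : Oracle) (i : Bool) :
    oracleMatrix O o i ∈ Matrix.unitaryGroup (Fin (o.width l m n) → Bool) ℂ := by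
  unfold oracleMatrix
  split_ifs
  · exact ((O o)⁻¹).2
  · exact (O o).2

lemma Op.toMatrix_mem_unitaryGroup {l m n N : ℕ} (O : OracleFamily l m n) (op : Op l m n N) :
    op.toMatrix O ∈ Matrix.unitaryGroup (Fin N → Bool) ℂ := by
  cases op with
  | gate k hk e g => exact onQubits_mem_unitaryGroup e g.2
  | query o i e => exact onQubits_mem_unitaryGroup e (oracleMatrix_mem_unitaryGroup O o i)
  | cquery o i e =>
    exact onQubits_mem_unitaryGroup e
      (controlled_mem_unitaryGroup (oracleMatrix_mem_unitaryGroup O o i))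

lemma Op.toMatrix_inv {l m n N : ℕ} (O : OracleFamily l m n) (op : Op l m n N) :
    op.inv.toMatrix O = (op.toMatrix O)ᴴ := by
  cases op with
  | gate k hk e g =>
    rw [Op.inv, Op.toMatrix, Op.toMatrix, onQubits_conjTranspose]
    rfl
  | query o i e =>
    rw [Op.inv, Op.toMatrix, Op.toMatrix, onQubits_conjTranspose, oracleMatrix_not]
  | cquery o i e =>
    rw [Op.inv, Op.toMatrix, Op.toMatrix, onQubits_conjTranspose, controlled_conjTranspose,
      oracleMatrix_not]

lemma Circuit.mat_mem_unitaryGroup {l m n N : ℕ} (O : OracleFamily l m n) (Q : Circuit l m n N) :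
    Circuit.mat O Q ∈ Matrix.unitaryGroup (Fin N → Bool) ℂ := by
  induction Q with
  | nil => exact one_mem _
  | cons op Q ih => exact mul_mem ih (Op.toMatrix_mem_unitaryGroup O op)

lemma Circuit.mat_inv {l m n N : ℕ} (O : OracleFamily l m n) (Q : Circuit l m n N) :
    Circuit.mat O Q.inv = (Circuit.mat O Q)ᴴ := by
  induction Q with
  | nil => simp [Circuit.inv, Circuit.mat]
  | cons op Q ih =>
    rw [Circuit.inv, List.map_cons, List.reverse_cons, Circuit.mat_append,
      ← Circuit.inv, ih]
    simp only [Circuit.mat]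
    rw [Matrix.one_mul, Op.toMatrix_inv, Matrix.conjTranspose_mul]

@[simp] lemma Circuit.length_inv {l m n N : ℕ} (Q : Circuit l m n N) :
    List.length Q.inv = List.length Q := by
  simp [Circuit.inv]

/-! ## Controlled one-qubit gates and the reversible OR -/

/-- Two distinct qubits. -/
def pairEmb {N : ℕ} (a b : Fin N) (h : a ≠ b) : Fin 2 ↪ Fin N :=
  ⟨![a, b], by
    intro s t hst
    fin_cases s <;> fin_cases t <;> simp_all [eq_comm]⟩

/-- A `2 × 2` matrix as an operator on a one-qubit register. -/
def oneQubit (V : Matrix Bool Bool ℂ) : Matrix (Fin 1 → Bool) (Fin 1 → Bool) ℂ :=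
  V.submatrix (Equiv.funUnique (Fin 1) Bool) (Equiv.funUnique (Fin 1) Bool)

lemma oneQubit_mem_unitaryGroup {V : Matrix Bool Bool ℂ} (hV : V ∈ Matrix.unitaryGroup Bool ℂ) :
    oneQubit V ∈ Matrix.unitaryGroup (Fin 1 → Bool) ℂ := by
  rw [Matrix.mem_unitaryGroup_iff] at hV ⊢
  rw [Matrix.star_eq_conjTranspose] at hV ⊢
  rw [oneQubit, Matrix.conjTranspose_submatrix, Matrix.submatrix_mul_equiv, hV,
    Matrix.submatrix_one_equiv]

/-- The one-qubit gate `V` on the qubit `a`, controlled by the qubit `c`. -/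
def cgate {l m n N : ℕ} (V : Matrix.unitaryGroup Bool ℂ) (c a : Fin N) : Circuit l m n N :=
  if h : c ≠ a then
    [Op.gate 2 le_rfl (pairEmb c a h)
      ⟨controlled (oneQubit V.val), controlled_mem_unitaryGroup (oneQubit_mem_unitaryGroup V.2)⟩]
  else []

lemma length_cgate_le {l m n N : ℕ} (V : Matrix.unitaryGroup Bool ℂ) (c a : Fin N) :
    List.length (cgate V c a : Circuit l m n N) ≤ 1 := by
  unfold cgate
  split_ifs <;> simp

lemma extend_pairEmb {N : ℕ} {c a : Fin N} (h : c ≠ a) (z : Fin 2 → Bool) (x : Fin N → Bool) :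
    Function.extend (pairEmb c a h) z x = Function.update (Function.update x a (z 1)) c (z 0) := by
  funext q
  by_cases hc : q = c
  · subst hc
    rw [Function.update_self]
    exact (pairEmb q a h).injective.extend_apply z x 0
  · by_cases ha : q = a
    · subst ha
      rw [Function.update_of_ne hc, Function.update_self]
      exact (pairEmb c q h).injective.extend_apply z x 1
    · rw [Function.update_of_ne hc, Function.update_of_ne ha, extend_of_avoid]
      intro t
      fin_cases t
      · exact fun h => hc h.symm
      · exact fun h => ha h.symm

lemma cgate_mulVec {l m n N : ℕ} (O : OracleFamily l m n) (V : Matrix.unitaryGroup Bool ℂ)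
    {c a : Fin N} (h : c ≠ a) (ψ : State N) (x : Fin N → Bool) :
    (Circuit.mat O (cgate V c a) *ᵥ ψ) x =
      if x c = true then V.val (x a) true * ψ (Function.update x a true)
        + V.val (x a) false * ψ (Function.update x a false) else ψ x := by
  rw [cgate, dif_pos h, Circuit.mat, Circuit.mat, Matrix.one_mul, Op.toMatrix, onQubits_mulVec]
  rw [← (finTwoArrowEquiv Bool).symm.sum_comp, Fintype.sum_prod_type]
  have h0 : (x ∘ pairEmb c a h) 0 = x c := rfl
  have h1 : Fin.tail (x ∘ pairEmb c a h) 0 = x a := rfl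
  have ht (p q : Bool) : Fin.tail (![p, q] : Fin 2 → Bool) 0 = q := rfl
  have hk (p q : Bool) : (Fin.tail (x ∘ pairEmb c a h) = Fin.tail ![p, q]) ↔ x a = q := by
    constructor
    · intro e
      have := congrFun e 0
      rwa [h1, ht] at this
    · intro e
      funext t
      rw [Subsingleton.elim t 0, h1, ht, e]
  have hx : Function.update x c (x c) = x := Function.update_eq_self c x
  have hax : Function.update x a (x a) = x := Function.update_eq_self a x
  have hu (q : Bool) : Function.update (Function.update x a q) c (x c) = Function.update x a q := by
    rw [Function.update_comm h.symm, hx]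
  simp only [extend_pairEmb, controlled, Matrix.of_apply, h0, finTwoArrowEquiv_symm_apply,
    Matrix.cons_val_zero, Matrix.cons_val_one, oneQubit, Matrix.submatrix_apply,
    Equiv.funUnique_apply, Matrix.one_apply, hk, Fin.default_eq_zero, h1, ht]
  cases hc : x c
  · rw [hc] at hx
    cases ha : x a <;> rw [ha] at hax <;> simp [hx, hax]
  · rw [hc] at hu
    simp [hu]

/-- The square root of the NOT gate. -/
def sqrtNot : Matrix.unitaryGroup Bool ℂ :=
  ⟨Matrix.of fun a b => if a = b then (1 + Complex.I) / 2 else (1 - Complex.I) / 2, by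
    rw [Matrix.mem_unitaryGroup_iff]
    ext a b
    rw [Matrix.mul_apply, Fintype.sum_bool]
    cases a <;> cases b <;> apply Complex.ext <;>
      simp [Matrix.star_apply] <;> norm_num⟩

/-- The NOT gate. -/
def notGate : Matrix.unitaryGroup Bool ℂ :=
  ⟨Matrix.of fun a b => if a = b then 0 else 1, by
    rw [Matrix.mem_unitaryGroup_iff]
    ext a b
    rw [Matrix.mul_apply, Fintype.sum_bool]
    cases a <;> cases b <;> simp [Matrix.star_apply]⟩

lemma cnot_mulVec {l m n N : ℕ} (O : OracleFamily l m n) {c a : Fin N} (h : c ≠ a)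
    (ψ : State N) (x : Fin N → Bool) :
    (Circuit.mat O (cgate notGate c a) *ᵥ ψ) x = ψ (Function.update x a (x a ^^ x c)) := by
  rw [cgate_mulVec O _ h]
  have hax : Function.update x a (x a) = x := Function.update_eq_self a x
  cases ha : x a <;> rw [ha] at hax <;> cases hc : x c <;> simp [notGate, hax]

lemma sqrtNot_mulVec {l m n N : ℕ} (O : OracleFamily l m n) {c a : Fin N} (h : c ≠ a)
    (ψ : State N) (x : Fin N → Bool) :
    (Circuit.mat O (cgate sqrtNot c a) *ᵥ ψ) x =
      if x c = true then (1 + Complex.I) / 2 * ψ x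
        + (1 - Complex.I) / 2 * ψ (Function.update x a (!x a)) else ψ x := by
  rw [cgate_mulVec O _ h]
  have hax : Function.update x a (x a) = x := Function.update_eq_self a x
  cases ha : x a <;> rw [ha] at hax <;> simp [sqrtNot, hax, add_comm]

/-- The reversible OR: it flips the qubit `a` if one of the qubits `c` and `p` is set. -/
def orGate {l m n N : ℕ} (c p a : Fin N) : Circuit l m n N :=
  (cgate sqrtNot c a ++ (cgate sqrtNot p a ++ (cgate notGate c p ++
    (cgate sqrtNot p a ++ cgate notGate c p : List _) : List _) : List _) : List _)

lemma length_orGate_le {l m n N : ℕ} (c p a : Fin N) :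
    List.length (orGate c p a : Circuit l m n N) ≤ 5 := by
  have h1 := length_cgate_le (l := l) (m := m) (n := n) sqrtNot c a
  have h2 := length_cgate_le (l := l) (m := m) (n := n) sqrtNot p a
  have h3 := length_cgate_le (l := l) (m := m) (n := n) notGate c p
  rw [orGate]
  simp only [List.length_append]
  omega

/-- The target receives c + p + (c xor p) = 2 (c or p) square roots of NOT, that is, one NOT exactly
when c or p is set. The second CNOT restores p. No three-qubit gate is needed. -/
lemma orGate_mulVec {l m n N : ℕ} (O : OracleFamily l m n) {c p a : Fin N} (hcp : c ≠ p)
    (hca : c ≠ a) (hpa : p ≠ a) (ψ : State N) :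
    Circuit.mat O (orGate c p a) *ᵥ ψ =
      fun x => ψ (Function.update x a (x a ^^ (x c || x p))) := by
  funext x
  have hax : Function.update x a (x a) = x := Function.update_eq_self a x
  have hpx : Function.update x p (x p) = x := Function.update_eq_self p x
  have hu (b : Bool) : Function.update (Function.update x a b) p (x p) = Function.update x a b := by
    rw [Function.update_comm hpa.symm, hpx]
  have hI : Complex.I ^ 2 = -1 := Complex.I_sq
  simp only [orGate, Circuit.mat_append, ← Matrix.mulVec_mulVec]
  simp only [cnot_mulVec O hcp, sqrtNot_mulVec O hca, sqrtNot_mulVec O hpa,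
    Function.update_self, Function.update_of_ne hcp, Function.update_of_ne hca,
    Function.update_of_ne hpa.symm, Function.update_comm hpa, Function.update_idem]
  cases ha : x a <;> rw [ha] at hax <;> cases hp : x p <;> rw [hp] at hpx hu <;>
    cases hc : x c <;> simp [hax, hpx, hu] <;> ring_nf <;> simp only [hI] <;> ring_nf

/-! ## Phases conditioned on a zero register -/

/-- The diagonal gate that multiplies by `ω` if the qubit is not set. -/
def phaseGate (ω : unitary ℂ) : Matrix.unitaryGroup (Fin 1 → Bool) ℂ :=
  ⟨Matrix.diagonal fun x => if x 0 = true then 1 else (ω : ℂ), by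
    rw [Matrix.mem_unitaryGroup_iff, Matrix.star_eq_conjTranspose,
      Matrix.diagonal_conjTranspose, Matrix.diagonal_mul_diagonal, ← Matrix.diagonal_one]
    congr 1
    funext x
    cases hx : x 0
    · simpa [hx] using Unitary.mul_star_self_of_mem ω.2
    · simp [hx]⟩

/-- A chain of ORs, computed into the qubits `a` of the pairs `(c, a)`, a phase that depends on
the last of them, and the same chain backwards. -/
def zeroPhase {l m n N : ℕ} (ω : unitary ℂ) :
    Fin N → List (Fin N × Fin N) → Circuit l m n N
  | p, [] => [Op.gate 1 one_le_two ⟨fun _ => p, Function.injective_of_subsingleton _⟩ (phaseGate ω)]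
  | p, (c, a) :: L => (orGate c p a ++ (zeroPhase ω a L ++ orGate c p a : List _) : List _)

lemma length_zeroPhase_le {l m n N : ℕ} (ω : unitary ℂ) (p : Fin N) (L : List (Fin N × Fin N)) :
    List.length (zeroPhase ω p L : Circuit l m n N) ≤ 10 * L.length + 1 := by
  induction L generalizing p with
  | nil => simp [zeroPhase]
  | cons ca L ih =>
    have h1 := ih ca.2
    have h2 := length_orGate_le (l := l) (m := m) (n := n) ca.1 p ca.2
    rw [zeroPhase, List.length_append, List.length_append, List.length_cons]
    omega

/-- Each OR is its own inverse, so the circuit conjugates a diagonal gate by a permutation of the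
basis and is diagonal on all states. If the targets start at zero, each comes to hold the OR of
everything before it, and the phase gate sees whether all tested qubits vanish. -/
lemma exists_zeroPhase_mulVec {l m n N : ℕ} (ω : unitary ℂ) (p : Fin N)
    (L : List (Fin N × Fin N)) (hp : ∀ u ∈ L, u.1 ≠ p ∧ p ≠ u.2) (hL : ∀ u ∈ L, u.1 ≠ u.2)
    (hLL : L.Pairwise fun u v => v.1 ≠ u.2 ∧ u.2 ≠ v.2) :
    ∃ ρ : (Fin N → Bool) → ℂ,
      (∀ (O : OracleFamily l m n) (ψ : State N),
        Circuit.mat O (zeroPhase ω p L) *ᵥ ψ = fun x => ρ x * ψ x) ∧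
      ∀ x, (∀ u ∈ L, x u.2 = false) →
        ρ x = if x p = false ∧ ∀ u ∈ L, x u.1 = false then (ω : ℂ) else 1 := by
  induction L generalizing p with
  | nil =>
    refine ⟨fun x => if x p = true then 1 else (ω : ℂ), fun O ψ => ?_, fun x _ => ?_⟩
    · funext x
      rw [zeroPhase, Circuit.mat, Circuit.mat, Matrix.one_mul, Op.toMatrix, onQubits_mulVec,
        Finset.sum_eq_single (x ∘ fun _ => p)]
      · simp only [phaseGate, Function.Embedding.coeFn_mk, Matrix.diagonal_apply_eq,
          Function.comp_apply]
        congr 2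
        exact extend_eq_of_agree
          (⟨fun _ => p, Function.injective_of_subsingleton _⟩ : Fin 1 ↪ Fin N) x x fun _ _ => rfl
      · intro z _ hz
        simp only [phaseGate, Function.Embedding.coeFn_mk]
        rw [Matrix.diagonal_apply_ne _ hz.symm, zero_mul]
      · simp
    · cases hx : x p <;> simp [hx]
  | cons ca L ih =>
    obtain ⟨c, a⟩ := ca
    rw [List.pairwise_cons] at hLL
    obtain ⟨ρ, h1, h2⟩ := ih a hLL.1 (fun u hu => hL u (List.mem_cons_of_mem _ hu)) hLL.2
    have hcp := (hp (c, a) List.mem_cons_self).1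
    have hpa := (hp (c, a) List.mem_cons_self).2
    have hca := hL (c, a) List.mem_cons_self
    simp only at hcp hpa hca
    refine ⟨fun x => ρ (Function.update x a (x a ^^ (x c || x p))), fun O ψ => ?_,
      fun x hx => ?_⟩
    · funext x
      simp only [zeroPhase, Circuit.mat_append, ← Matrix.mulVec_mulVec]
      rw [orGate_mulVec O hcp hca hpa, h1, orGate_mulVec O hcp hca hpa]
      simp [Function.update_of_ne hca, Function.update_of_ne hpa]
    · have ha : x a = false := hx (c, a) List.mem_cons_self
      have hne (u) (hu : u ∈ L) := hLL.1 u hu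
      change ρ _ = _
      rw [h2]
      · congr 1
        simp only [Function.update_self, ha, Bool.false_xor, Bool.or_eq_false_iff,
          List.forall_mem_cons, eq_iff_iff]
        have : (∀ u ∈ L, Function.update x a (x c || x p) u.1 = false) ↔
            ∀ u ∈ L, x u.1 = false :=
          forall₂_congr fun u hu => by rw [Function.update_of_ne (hne u hu).1]
        rw [this]
        tauto
      · intro u hu
        rw [Function.update_of_ne (hne u hu).2.symm]
        exact hx u (List.mem_cons_of_mem _ hu)

/-! ## Copying a register -/

/-- The circuit that adds the bits `e t` to the bits `f t`, for the `t` in a list. -/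
def copyBits {l m n N k : ℕ} (e f : Fin k → Fin N) : List (Fin k) → Circuit l m n N
  | [] => []
  | t :: L => (cgate notGate (e t) (f t) ++ copyBits e f L : List _)

lemma length_copyBits_le {l m n N k : ℕ} (e f : Fin k → Fin N) (L : List (Fin k)) :
    List.length (copyBits e f L : Circuit l m n N) ≤ L.length := by
  induction L with
  | nil => simp [copyBits]
  | cons t L ih =>
    have := length_cgate_le (l := l) (m := m) (n := n) notGate (e t) (f t)
    rw [copyBits, List.length_append, List.length_cons]
    omega

lemma exists_copyBits_mulVec {l m n N k : ℕ} (e f : Fin k → Fin N) (hf : Function.Injective f)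
    (hef : ∀ s t, e s ≠ f t) (L : List (Fin k)) (hL : L.Nodup) :
    ∃ σ : (Fin N → Bool) → Fin N → Bool,
      (∀ (O : OracleFamily l m n) (ψ : State N),
        Circuit.mat O (copyBits e f L) *ᵥ ψ = fun x => ψ (σ x)) ∧
      (∀ x t, σ x (f t) = if t ∈ L then (x (f t) ^^ x (e t)) else x (f t)) ∧
      ∀ x q, (∀ t, q ≠ f t) → σ x q = x q := by
  induction L with
  | nil => exact ⟨id, fun O ψ => by simp [copyBits, Circuit.mat], by simp, by simp⟩
  | cons t L ih =>
    rw [List.nodup_cons] at hL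
    obtain ⟨σ, h1, h2, h3⟩ := ih hL.2
    refine ⟨fun x => Function.update (σ x) (f t) (σ x (f t) ^^ σ x (e t)), fun O ψ => ?_,
      fun x s => ?_, fun x q hq => ?_⟩
    · funext x
      rw [copyBits, Circuit.mat_append, ← Matrix.mulVec_mulVec, h1]
      exact cnot_mulVec O (hef t t) ψ (σ x)
    · by_cases hs : s = t
      · subst hs
        simp [h2, hL.1, h3 x (e s) (hef s)]
      · simp [hf.ne hs, h2, hs]
    · change Function.update _ _ _ q = _
      rw [Function.update_of_ne (hq t), h3 x q hq]

/-! ## Fixed-point amplitude amplification -/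

lemma State.norm_sq {N : ℕ} (ψ : State N) : State.norm ψ ^ 2 = ∑ x, ‖ψ x‖ ^ 2 := by
  rw [State.norm, EuclideanSpace.norm_sq_eq]

lemma State.norm_sq_mulVec_ketZero {N : ℕ} {V : Matrix (Fin N → Bool) (Fin N → Bool) ℂ}
    (hV : V ∈ Matrix.unitaryGroup (Fin N → Bool) ℂ) :
    ∑ x, ‖(V *ᵥ ketZero N) x‖ ^ 2 = 1 := by
  rw [Matrix.mem_unitaryGroup_iff', Matrix.star_eq_conjTranspose] at hV
  have h := congrFun (congrFun hV fun _ => false) fun _ => false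
  rw [Matrix.mul_apply, Matrix.one_apply_eq] at h
  rw [ketZero, ket, Matrix.mulVec_single_one, ← Complex.ofReal_inj, Complex.ofReal_one, ← h]
  push_cast
  refine Finset.sum_congr rfl fun x _ => ?_
  rw [Matrix.conjTranspose_apply, Matrix.col_apply, ← Complex.conj_mul']
  rfl

/-- An operator maps states supported on basis states in `C` to such states. -/
def PreservesSupport {N : ℕ} (C : Set (Fin N → Bool))
    (M : Matrix (Fin N → Bool) (Fin N → Bool) ℂ) : Prop :=
  ∀ ψ : State N, (∀ x ∉ C, ψ x = 0) → ∀ x ∉ C, (M *ᵥ ψ) x = 0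

lemma PreservesSupport.mul {N : ℕ} {C : Set (Fin N → Bool)}
    {M M' : Matrix (Fin N → Bool) (Fin N → Bool) ℂ} (h : PreservesSupport C M)
    (h' : PreservesSupport C M') : PreservesSupport C (M * M') := fun ψ hψ => by
  rw [← Matrix.mulVec_mulVec]
  exact h _ (h' _ hψ)

lemma PreservesSupport.diagonal {N : ℕ} {C : Set (Fin N → Bool)} (ρ : (Fin N → Bool) → ℂ) :
    PreservesSupport C (Matrix.diagonal ρ) := fun ψ hψ x hx => by
  rw [Matrix.mulVec_diagonal, hψ x hx, mul_zero]

/-- One step of the amplification, for a phase `ω` with `ω² = ω - 1`. -/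
lemma amplification_step {N : ℕ} {C T : Set (Fin N → Bool)} {ω : ℂ} (hω : ω ^ 2 = ω - 1)
    {V : Matrix (Fin N → Bool) (Fin N → Bool) ℂ}
    (hV : V ∈ Matrix.unitaryGroup (Fin N → Bool) ℂ) (hCV : PreservesSupport C V)
    (hCV' : PreservesSupport C Vᴴ) (h0 : (fun _ => false) ∈ C) {ρs ρt : (Fin N → Bool) → ℂ}
    (hs : ∀ x ∈ C, (x = fun _ => false) → ρs x = ω)
    (hs' : ∀ x ∈ C, (x ≠ fun _ => false) → ρs x = 1)
    (ht : ∀ x ∈ T, ρt x = ω) (ht' : ∀ x ∈ C, x ∉ T → ρt x = 1) :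
    ∃ c : ℂ,
      (∀ x ∈ T, ((V * (Matrix.diagonal ρs * (Vᴴ * (Matrix.diagonal ρt * V)))) *ᵥ ketZero N) x
        = c * (V *ᵥ ketZero N) x) ∧
      ∀ x ∉ T, ((V * (Matrix.diagonal ρs * (Vᴴ * (Matrix.diagonal ρt * V)))) *ᵥ ketZero N) x
        = ω * (∑ y, Set.indicator Tᶜ (fun y => ‖(V *ᵥ ketZero N) y‖ ^ 2) y : ℝ)
          * (V *ᵥ ketZero N) x := by
  classical
  set ψ : State N := V *ᵥ ketZero N with hψ
  set δ : ℝ := ∑ y, Set.indicator Tᶜ (fun y => ‖ψ y‖ ^ 2) y with hδ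
  have hψC : ∀ x ∉ C, ψ x = 0 := hCV _ fun x hx => by
    rw [ketZero, ket, Pi.single_eq_of_ne]
    rintro rfl
    exact hx h0
  set χ : State N := Matrix.diagonal ρt *ᵥ ψ with hχ
  have hχx (x) : χ x = ρt x * ψ x := by rw [hχ, Matrix.mulVec_diagonal]
  have hχC : ∀ x ∉ C, χ x = 0 := fun x hx => by rw [hχx, hψC x hx, mul_zero]
  set φ : State N := Vᴴ *ᵥ χ with hφ
  have hφC : ∀ x ∉ C, φ x = 0 := hCV' _ hχC
  -- This is the inner product of ψ with its image under the target phase: weight 1 - δ on `T` with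
  -- phase ω, weight δ elsewhere with phase 1.
  have hφ0 : φ (fun _ => false) = ω * (1 - δ) + δ := by
    have e1 : φ (fun _ => false) = ∑ x, ρt x * (‖ψ x‖ ^ 2 : ℝ) := by
      rw [hφ, Matrix.mulVec, dotProduct]
      refine Finset.sum_congr rfl fun x _ => ?_
      rw [hχx, Matrix.conjTranspose_apply,
        show V x (fun _ => false) = ψ x by rw [hψ, ketZero, ket, Matrix.mulVec_single_one]; rfl]
      push_cast
      rw [← Complex.conj_mul']
      change (starRingEnd ℂ) (ψ x) * _ = _
      ring
    have e2 : (∑ x, ‖ψ x‖ ^ 2 : ℝ) = 1 := State.norm_sq_mulVec_ketZero hV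
    rw [e1, ← Complex.ofReal_one, ← e2, hδ, ← Complex.ofReal_sub, ← Finset.sum_sub_distrib,
      Complex.ofReal_sum, Complex.ofReal_sum, Finset.mul_sum, ← Finset.sum_add_distrib]
    refine Finset.sum_congr rfl fun x _ => ?_
    by_cases hxT : x ∈ T
    · rw [ht x hxT, Set.indicator_of_notMem (by simpa using hxT)]
      simp
    · rw [Set.indicator_of_mem (by simpa using hxT)]
      by_cases hxC : x ∈ C
      · rw [ht' x hxC hxT]
        simp
      · rw [hψC x hxC]
        simp
  -- For states supported in `C` the initial phase is 1 - (1 - ω)|0⟩⟨0|. Since `ρs` is unknown off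
  -- `C`, φ must be supported there, which is what `hCV'` provides.
  have hR : Matrix.diagonal ρs *ᵥ φ = φ - ((1 - ω) * φ fun _ => false) • ketZero N := by
    funext x
    rw [Matrix.mulVec_diagonal, Pi.sub_apply, Pi.smul_apply, smul_eq_mul, ketZero, ket]
    by_cases hxC : x ∈ C
    · by_cases hx : x = fun _ => false
      · rw [hs x hxC hx, hx, Pi.single_eq_same]
        ring
      · rw [hs' x hxC hx, Pi.single_eq_of_ne hx]
        ring
    · rw [hφC x hxC, Pi.single_eq_of_ne]
      · ring
      · rintro rfl
        exact hxC h0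
  have hVV : V *ᵥ φ = χ := by
    rw [Matrix.mem_unitaryGroup_iff, Matrix.star_eq_conjTranspose] at hV
    rw [hφ, Matrix.mulVec_mulVec, hV, Matrix.one_mulVec]
  have key (x) : ((V * (Matrix.diagonal ρs * (Vᴴ * (Matrix.diagonal ρt * V)))) *ᵥ ketZero N) x
      = ρt x * ψ x - (1 - ω) * (ω * (1 - δ) + δ) * ψ x := by
    simp only [← Matrix.mulVec_mulVec]
    rw [← hψ, ← hχ, ← hφ, hR, Matrix.mulVec_sub, Matrix.mulVec_smul, ← hψ, hVV, hφ0,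
      Pi.sub_apply, Pi.smul_apply, smul_eq_mul, hχx]
  refine ⟨ω - (1 - ω) * (ω * (1 - δ) + δ), fun x hx => ?_, fun x hx => ?_⟩
  · rw [key, ht x hx]
    ring
  · rw [key]
    by_cases hxC : x ∈ C
    · rw [ht' x hxC hx]
      -- The factor is 1 - (1 - ω)(ω(1 - δ) + δ); since (1 - ω)ω = 1 by `hω`, only ωδ remains.
      linear_combination (1 - (δ : ℂ)) * ψ x * hω
    · rw [hψC x hxC]
      ring

/-- The recursion of fixed-point amplitude amplification. -/
def amplify {l m n N : ℕ} (W Rs Rt : Circuit l m n N) : ℕ → Circuit l m n N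
  | 0 => W
  | k + 1 => (amplify W Rs Rt k ++ (Rt ++ ((amplify W Rs Rt k).inv ++
      (Rs ++ amplify W Rs Rt k : List _) : List _) : List _) : List _)

/-- Adding the lengths of `Rs` and `Rt` on the left lets the induction close: a level contains the
previous one three times but each reflection once. -/
lemma length_amplify_le {l m n N : ℕ} (W Rs Rt : Circuit l m n N) (k : ℕ) :
    List.length (amplify W Rs Rt k) + List.length Rs + List.length Rt
      ≤ 3 ^ k * (List.length W + List.length Rs + List.length Rt) := by
  induction k with
  | zero => simp [amplify]
  | succ k ih =>
    rw [amplify]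
    simp only [List.length_append, Circuit.length_inv, pow_succ]
    nlinarith

/-- Off `T` each step multiplies all amplitudes by a number of modulus δ, so their weight goes from
δ to δ² · δ. On `T` only a common scalar appears; its value is not needed, since the failure weight
will determine its modulus. -/
lemma exists_amplify_mulVec {l m n N : ℕ} (O : OracleFamily l m n) {W Rs Rt : Circuit l m n N}
    {C T : Set (Fin N → Bool)} {ω : ℂ} (hω : ω ^ 2 = ω - 1) (hω1 : ‖ω‖ = 1)
    (hCW : PreservesSupport C (Circuit.mat O W)) (hCW' : PreservesSupport C (Circuit.mat O W)ᴴ)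
    (h0 : (fun _ => false) ∈ C) {ρs ρt : (Fin N → Bool) → ℂ}
    (hRs : Circuit.mat O Rs = Matrix.diagonal ρs) (hRt : Circuit.mat O Rt = Matrix.diagonal ρt)
    (hs : ∀ x ∈ C, (x = fun _ => false) → ρs x = ω)
    (hs' : ∀ x ∈ C, (x ≠ fun _ => false) → ρs x = 1)
    (ht : ∀ x ∈ T, ρt x = ω) (ht' : ∀ x ∈ C, x ∉ T → ρt x = 1) (k : ℕ) :
    ∃ c : ℂ,
      (∀ x ∈ T, (Circuit.mat O (amplify W Rs Rt k) *ᵥ ketZero N) x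
        = c * (Circuit.mat O W *ᵥ ketZero N) x) ∧
      ∑ x, Set.indicator Tᶜ
          (fun x => ‖(Circuit.mat O (amplify W Rs Rt k) *ᵥ ketZero N) x‖ ^ 2) x =
        (∑ x, Set.indicator Tᶜ (fun x => ‖(Circuit.mat O W *ᵥ ketZero N) x‖ ^ 2) x) ^ 3 ^ k := by
  have hmat (k) : Circuit.mat O (amplify W Rs Rt (k + 1)) =
      Circuit.mat O (amplify W Rs Rt k) * (Matrix.diagonal ρs *
        ((Circuit.mat O (amplify W Rs Rt k))ᴴ *
          (Matrix.diagonal ρt * Circuit.mat O (amplify W Rs Rt k)))) := by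
    simp only [amplify, Circuit.mat_append, hRs, hRt, Circuit.mat_inv, Matrix.mul_assoc]
  have hsupp (k) : PreservesSupport C (Circuit.mat O (amplify W Rs Rt k)) ∧
      PreservesSupport C (Circuit.mat O (amplify W Rs Rt k))ᴴ := by
    induction k with
    | zero => exact ⟨hCW, hCW'⟩
    | succ k ih =>
      rw [hmat]
      simp only [Matrix.conjTranspose_mul, Matrix.conjTranspose_conjTranspose,
        Matrix.diagonal_conjTranspose]
      exact ⟨ih.1.mul ((PreservesSupport.diagonal _).mul
          (ih.2.mul ((PreservesSupport.diagonal _).mul ih.1))),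
        (((ih.2.mul (PreservesSupport.diagonal _)).mul ih.1).mul
          (PreservesSupport.diagonal _)).mul ih.2⟩
  induction k with
  | zero => exact ⟨1, fun x _ => by rw [amplify, one_mul], by simp [amplify]⟩
  | succ k ih =>
    obtain ⟨c, hc, hd⟩ := ih
    obtain ⟨c', hc', hd'⟩ := amplification_step hω (Circuit.mat_mem_unitaryGroup O _)
      (hsupp k).1 (hsupp k).2 h0 hs hs' ht ht'
    rw [← hmat] at hc' hd'
    refine ⟨c' * c, fun x hx => by rw [hc' x hx, hc x hx, mul_assoc], ?_⟩
    rw [pow_succ, pow_mul, ← hd]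
    rw [hd] at hd'
    have hδ : 0 ≤ ∑ x, Set.indicator Tᶜ (fun x => ‖(Circuit.mat O W *ᵥ ketZero N) x‖ ^ 2) x :=
      Finset.sum_nonneg fun x _ => Set.indicator_nonneg (fun _ _ => sq_nonneg _) _
    rw [show ∀ a : ℝ, a ^ 3 = a ^ 2 * a by intro a; ring]
    nth_rewrite 2 [hd]
    rw [hd, ← hd, Finset.mul_sum]
    refine Finset.sum_congr rfl fun x _ => ?_
    by_cases hx : x ∈ T
    · rw [Set.indicator_of_notMem (by simpa using hx),
        Set.indicator_of_notMem (by simpa using hx), mul_zero]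
    · rw [Set.indicator_of_mem (by simpa using hx), Set.indicator_of_mem (by simpa using hx),
        hd' x hx, norm_mul, norm_mul, hω1, Complex.norm_real, hd, Real.norm_of_nonneg (by positivity)]
      ring

/-! ## Amplitudes of the encoded vectors and matrices -/

/-- The bits of an index. -/
def bits {d : ℕ} (k : Fin d) : Fin (qubits d) → Bool := fun t => Nat.testBit k.val t.val

lemma bits_injective (d : ℕ) : Function.Injective (bits : Fin d → Fin (qubits d) → Bool) := by
  intro i j h
  refine Fin.ext (Nat.eq_of_testBit_eq fun t => ?_)
  by_cases ht : t < qubits d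
  · exact congrFun h ⟨t, ht⟩
  · have hp : d ≤ 2 ^ t :=
      (Nat.le_pow_clog one_lt_two d).trans (Nat.pow_le_pow_right two_pos (not_lt.mp ht))
    rw [Nat.testBit_eq_false_of_lt (i.2.trans_le hp), Nat.testBit_eq_false_of_lt (j.2.trans_le hp)]

lemma idx_apply {d : ℕ} (k : Fin d) (y : Fin (qubits d) → Bool) :
    idx k y = if y = bits k then 1 else 0 := by
  rw [idx, ket, Pi.single_apply]
  rfl

lemma vecState_apply {d : ℕ} (v : Fin d → ℝ) (y : Fin (qubits d) → Bool) :
    vecState v y = ∑ k, ((v k / vecNorm v : ℝ) : ℂ) * idx k y := by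
  simp [vecState, Finset.sum_apply]

lemma vecState_bits {d : ℕ} (v : Fin d → ℝ) (k : Fin d) :
    vecState v (bits k) = ((v k / vecNorm v : ℝ) : ℂ) := by
  rw [vecState_apply, Finset.sum_eq_single k]
  · rw [idx_apply, if_pos rfl, mul_one]
  · intro j _ hj
    rw [idx_apply, if_neg ((bits_injective d).ne hj.symm), mul_zero]
  · simp

lemma vecState_of_notMem {d : ℕ} (v : Fin d → ℝ) {y : Fin (qubits d) → Bool}
    (hy : ∀ k : Fin d, y ≠ bits k) : vecState v y = 0 := by
  rw [vecState_apply]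
  exact Finset.sum_eq_zero fun k _ => by rw [idx_apply, if_neg (hy k), mul_zero]

lemma sum_vecState_mul {d : ℕ} (v : Fin d → ℝ) (f : State (qubits d)) :
    ∑ y, vecState v y * f y = ∑ k, ((v k / vecNorm v : ℝ) : ℂ) * f (bits k) := by
  simp only [vecState_apply, Finset.sum_mul]
  rw [Finset.sum_comm]
  refine Finset.sum_congr rfl fun k _ => ?_
  rw [Finset.sum_eq_single (bits k)]
  · rw [idx_apply, if_pos rfl, mul_one]
  · intro y _ hy
    rw [idx_apply, if_neg hy, mul_zero, zero_mul]
  · simp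

lemma star_vecState {d : ℕ} (v : Fin d → ℝ) (y : Fin (qubits d) → Bool) :
    star (vecState v y) = vecState v y := by
  simp only [vecState_apply, star_sum, star_mul', idx_apply]
  refine Finset.sum_congr rfl fun k _ => ?_
  congr 1
  · exact Complex.conj_ofReal _
  · split_ifs <;> simp

lemma tensor_append {a b : ℕ} (ψ : State a) (φ : State b) (y : Fin a → Bool) (z : Fin b → Bool) :
    tensor ψ φ (Fin.append y z) = ψ y * φ z := by
  simp [tensor]

lemma sum_append {a b : ℕ} {M : Type*} [AddCommMonoid M] (f : (Fin (a + b) → Bool) → M) :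
    ∑ x, f x = ∑ y : Fin a → Bool, ∑ z : Fin b → Bool, f (Fin.append y z) := by
  rw [← (Fin.appendEquiv a b).sum_comp, Fintype.sum_prod_type]
  rfl

lemma sum_norm_sq_tensor {a b : ℕ} (ψ : State a) (φ : State b) :
    ∑ x, ‖tensor ψ φ x‖ ^ 2 = (∑ y, ‖ψ y‖ ^ 2) * ∑ z, ‖φ z‖ ^ 2 := by
  rw [sum_append, Finset.sum_mul_sum]
  simp only [tensor_append, norm_mul, mul_pow]

lemma matState_append {l n : ℕ} (M : Matrix (Fin l) (Fin n) ℝ) (y : Fin (qubits l) → Bool)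
    (z : Fin (qubits n) → Bool) :
    matState M (Fin.append y z) = ∑ i, ∑ j, ((M i j / ‖M‖ : ℝ) : ℂ) * (idx i y * idx j z) := by
  simp [matState, Finset.sum_apply, tensor_append]

lemma matState_append_bits {l n : ℕ} (M : Matrix (Fin l) (Fin n) ℝ) (y : Fin (qubits l) → Bool)
    (j : Fin n) :
    matState M (Fin.append y (bits j)) = ∑ i, ((M i j / ‖M‖ : ℝ) : ℂ) * idx i y := by
  rw [matState_append]
  refine Finset.sum_congr rfl fun i _ => ?_
  rw [Finset.sum_eq_single j]
  · rw [idx_apply j, if_pos rfl, mul_one]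
  · intro j' _ hj
    rw [idx_apply j', if_neg ((bits_injective n).ne hj.symm), mul_zero, mul_zero]
  · simp

lemma matState_append_of_notMem {l n : ℕ} (M : Matrix (Fin l) (Fin n) ℝ)
    (y : Fin (qubits l) → Bool) {z : Fin (qubits n) → Bool} (hz : ∀ j : Fin n, z ≠ bits j) :
    matState M (Fin.append y z) = 0 := by
  rw [matState_append]
  refine Finset.sum_eq_zero fun i _ => Finset.sum_eq_zero fun j _ => ?_
  rw [idx_apply j, if_neg (hz j), mul_zero, mul_zero]

lemma frobenius_norm_sq {l n : ℕ} (M : Matrix (Fin l) (Fin n) ℝ) :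
    ‖M‖ ^ 2 = ∑ i, ∑ j, M i j ^ 2 := by
  rw [Matrix.frobenius_norm_def, ← Real.sqrt_eq_rpow, Real.sq_sqrt (by positivity)]
  simp

lemma vecNorm_sq {d : ℕ} (v : Fin d → ℝ) : vecNorm v ^ 2 = ∑ k, v k ^ 2 := by
  rw [vecNorm, EuclideanSpace.norm_sq_eq]
  simp

lemma vecNorm_nonneg {d : ℕ} (v : Fin d → ℝ) : 0 ≤ vecNorm v := norm_nonneg _

lemma vecNorm_eq_zero {d : ℕ} {v : Fin d → ℝ} : vecNorm v = 0 ↔ v = 0 := by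
  rw [vecNorm, norm_eq_zero, WithLp.toLp_eq_zero]

lemma vecNorm_rowNorms {l n : ℕ} (M : Matrix (Fin l) (Fin n) ℝ) : vecNorm (rowNorms M) = ‖M‖ := by
  rw [← sq_eq_sq₀ (vecNorm_nonneg _) (norm_nonneg _), vecNorm_sq, frobenius_norm_sq]
  exact Finset.sum_congr rfl fun i _ => vecNorm_sq _

lemma vecNorm_colNorms {l n : ℕ} (M : Matrix (Fin l) (Fin n) ℝ) : vecNorm (colNorms M) = ‖M‖ := by
  rw [colNorms, vecNorm_rowNorms, Matrix.frobenius_norm_transpose]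

lemma sum_norm_sq_matState {l n : ℕ} {M : Matrix (Fin l) (Fin n) ℝ} (hM : M ≠ 0) :
    ∑ x, ‖matState M x‖ ^ 2 = 1 := by
  rw [sum_append, Finset.sum_comm]
  have hz (z : Fin (qubits n) → Bool) :
      ∑ y, ‖matState M (Fin.append y z)‖ ^ 2
        = ∑ j, if z = bits j then ∑ i, (M i j / ‖M‖) ^ 2 else 0 := by
    by_cases h : ∃ j, z = bits j
    · obtain ⟨j, rfl⟩ := h
      rw [Finset.sum_eq_single j]
      · rw [if_pos rfl, ← Finset.sum_subset (Finset.subset_univ (Finset.univ.image bits))]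
        · rw [Finset.sum_image fun _ _ _ _ h => bits_injective l h]
          refine Finset.sum_congr rfl fun i _ => ?_
          rw [matState_append_bits, Finset.sum_eq_single i]
          · rw [idx_apply, if_pos rfl, mul_one, Complex.norm_real, Real.norm_eq_abs, sq_abs]
          · intro i' _ hi
            rw [idx_apply, if_neg ((bits_injective l).ne hi.symm), mul_zero]
          · simp
        · intro y _ hy
          rw [matState_append_bits, Finset.sum_eq_zero]
          · simp
          · intro i _
            rw [idx_apply, if_neg, mul_zero]
            rintro rfl
            exact hy (Finset.mem_image_of_mem _ (Finset.mem_univ _))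
      · intro j' _ hj
        rw [if_neg ((bits_injective n).ne hj.symm)]
      · simp
    · push Not at h
      rw [Finset.sum_eq_zero fun y _ => by rw [matState_append_of_notMem M y h, norm_zero,
        zero_pow two_ne_zero], Finset.sum_eq_zero fun j _ => if_neg (h j)]
  simp only [hz]
  rw [Finset.sum_comm]
  simp only [Finset.sum_ite_eq', Finset.mem_univ, if_true, div_pow]
  rw [Finset.sum_comm]
  simp only [← Finset.sum_div]
  rw [← frobenius_norm_sq, div_self]
  exact pow_ne_zero _ (norm_ne_zero_iff.mpr hM)

lemma ketZero_apply {N : ℕ} (x : Fin N → Bool) :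
    ketZero N x = if x = fun _ => false then 1 else 0 := by
  rw [ketZero, ket, Pi.single_apply]

lemma sum_norm_sq_ketZero (N : ℕ) : ∑ x, ‖ketZero N x‖ ^ 2 = 1 := by
  rw [Finset.sum_eq_single fun _ => false]
  · simp [ketZero_apply]
  · intro x _ hx
    simp [ketZero_apply, hx]
  · simp

/-- If the part of `ψ` on which the work qubits vanish is a multiple of `φ`, and the rest of `ψ`
is small, then `ψ` is close to `φ ⊗ χ` for some `χ`. -/
lemma exists_norm_sub_tensor_le {a w : ℕ} {ψ : State (a + w)} {φ : State a} {c : ℂ} {ε : ℝ}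
    (hψ : ∑ x, ‖ψ x‖ ^ 2 = 1) (hφ : ∑ x, ‖φ x‖ ^ 2 = 1) (hε : 0 ≤ ε)
    (hc : ∀ y, ψ (Fin.append y fun _ => false) = c * φ y)
    (hδ : 2 * (1 - ‖c‖ ^ 2) ≤ ε ^ 2) :
    ∃ χ : State w, State.norm χ = 1 ∧ State.norm (ψ - tensor φ χ) ≤ ε := by
  -- The phase of `c` is absorbed into χ. Defined through `Complex.arg`, it has modulus one even if
  -- `c` is zero.
  set γ : ℂ := Complex.exp (Complex.arg c * Complex.I) with hγ
  have hγ1 : ‖γ‖ = 1 := Complex.norm_exp_ofReal_mul_I _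
  have hcγ : c = ‖c‖ * γ := (Complex.norm_mul_exp_arg_mul_I c).symm
  refine ⟨γ • ketZero w, ?_, ?_⟩
  · have h : State.norm (γ • ketZero w) ^ 2 = 1 := by
      simp only [State.norm_sq, Pi.smul_apply, norm_smul, hγ1, one_mul, sum_norm_sq_ketZero]
    exact (pow_eq_one_iff_of_nonneg (norm_nonneg _) two_ne_zero).mp h
  · refine le_of_sq_le_sq ?_ hε
    rw [State.norm_sq, sum_append]
    have hsplit (f : (Fin w → Bool) → ℝ) :
        ∑ z, f z = f (fun _ => false) + ∑ z ∈ Finset.univ.erase fun _ => false, f z :=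
      (Finset.add_sum_erase _ f (Finset.mem_univ _)).symm
    have e1 : (∑ y : Fin a → Bool, ∑ z ∈ Finset.univ.erase (fun _ : Fin w => false),
        ‖ψ (Fin.append y z)‖ ^ 2) = 1 - ‖c‖ ^ 2 := by
      rw [← hψ, sum_append]
      simp only [hsplit, Finset.sum_add_distrib, hc, norm_mul, mul_pow]
      rw [← Finset.mul_sum, hφ]
      ring
    have e2 (y : Fin a → Bool) (z) (hz : z ∈ Finset.univ.erase (fun _ : Fin w => false)) :
        ‖(ψ - tensor φ (γ • ketZero w)) (Fin.append y z)‖ ^ 2 = ‖ψ (Fin.append y z)‖ ^ 2 := by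
      rw [Pi.sub_apply, tensor_append, Pi.smul_apply, ketZero_apply,
        if_neg (Finset.ne_of_mem_erase hz), smul_zero, mul_zero, sub_zero]
    have e3 (y : Fin a → Bool) :
        ‖(ψ - tensor φ (γ • ketZero w)) (Fin.append y fun _ => false)‖ ^ 2
          = (‖c‖ - 1) ^ 2 * ‖φ y‖ ^ 2 := by
      rw [Pi.sub_apply, tensor_append, Pi.smul_apply, ketZero_apply, if_pos rfl, hc]
      nth_rewrite 1 [hcγ]
      rw [show (‖c‖ : ℂ) * γ * φ y - φ y * γ • (1 : ℂ) = ((‖c‖ - 1 : ℝ) : ℂ) * γ * φ y by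
        push_cast; rw [smul_eq_mul]; ring, norm_mul, norm_mul, hγ1, mul_one, mul_pow,
        Complex.norm_real, Real.norm_eq_abs, sq_abs]
    simp only [hsplit, Finset.sum_add_distrib, e3]
    rw [Finset.sum_congr rfl fun y _ => Finset.sum_congr rfl (e2 y), e1, ← Finset.mul_sum, hφ]
    have h0 : 0 ≤ 1 - ‖c‖ ^ 2 := by
      rw [← e1]
      positivity
    -- The squared distance is (1 - |c|²) + (1 - |c|)² = 2 - 2|c|, at most 2(1 - |c|²) because |c| ≤
    -- 1.
    nlinarith [norm_nonneg c]

/-- Outside the basis states whose work qubits vanish, `ψ` has the weight that is left. -/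
lemma sum_indicator_compl_norm_sq {a w : ℕ} {ψ : State (a + w)} {φ : State a} {c : ℂ}
    (hψ : ∑ x, ‖ψ x‖ ^ 2 = 1) (hφ : ∑ x, ‖φ x‖ ^ 2 = 1)
    (hc : ∀ y, ψ (Fin.append y fun _ => false) = c * φ y) :
    ∑ x, Set.indicator {x : Fin (a + w) → Bool | ∀ t, x (Fin.natAdd a t) = false}ᶜ
      (fun x => ‖ψ x‖ ^ 2) x = 1 - ‖c‖ ^ 2 := by
  classical
  have h (x : Fin (a + w) → Bool) :
      Set.indicator {x : Fin (a + w) → Bool | ∀ t, x (Fin.natAdd a t) = false}ᶜ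
        (fun x => ‖ψ x‖ ^ 2) x
      = ‖ψ x‖ ^ 2 - if ∀ t, x (Fin.natAdd a t) = false then ‖ψ x‖ ^ 2 else 0 := by
    simp only [Set.indicator_apply, Set.mem_compl_iff, Set.mem_ofPred_eq]
    split_ifs <;> simp_all
  simp only [h, Finset.sum_sub_distrib, hψ]
  congr 1
  rw [sum_append]
  simp only [Fin.append_right]
  have h' (y : Fin a → Bool) : (∑ z : Fin w → Bool,
      if ∀ t, z t = false then ‖ψ (Fin.append y z)‖ ^ 2 else 0) = ‖c‖ ^ 2 * ‖φ y‖ ^ 2 := by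
    rw [Finset.sum_eq_single fun _ => false]
    · rw [if_pos fun _ => rfl, hc, norm_mul, mul_pow]
    · intro z _ hz
      exact if_neg fun h => hz (funext h)
    · simp
  simp only [h']
  rw [← Finset.mul_sum, hφ, mul_one]

/-! ## The registers -/

/-- Two disjoint registers. -/
def joinEmb {a b N : ℕ} (e : Fin a ↪ Fin N) (f : Fin b ↪ Fin N) (h : ∀ s t, e s ≠ f t) :
    Fin (a + b) ↪ Fin N :=
  ⟨Fin.append e f, by
    intro s t
    refine Fin.addCases (fun s => ?_) (fun s => ?_) s <;>
      refine Fin.addCases (fun t => ?_) (fun t => ?_) t <;>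
      simp only [Fin.append_left, Fin.append_right]
    · exact fun hst => congrArg _ (e.injective hst)
    · exact fun hst => absurd hst (h s t)
    · exact fun hst => absurd hst.symm (h t s)
    · exact fun hst => congrArg _ (f.injective hst)⟩

lemma joinEmb_castAdd {a b N : ℕ} (e : Fin a ↪ Fin N) (f : Fin b ↪ Fin N)
    (h : ∀ s t, e s ≠ f t) (s : Fin a) : joinEmb e f h (Fin.castAdd b s) = e s :=
  Fin.append_left e f s

lemma joinEmb_natAdd {a b N : ℕ} (e : Fin a ↪ Fin N) (f : Fin b ↪ Fin N)
    (h : ∀ s t, e s ≠ f t) (s : Fin b) : joinEmb e f h (Fin.natAdd a s) = f s :=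
  Fin.append_right e f s

lemma comp_joinEmb {a b N : ℕ} (e : Fin a ↪ Fin N) (f : Fin b ↪ Fin N) (h : ∀ s t, e s ≠ f t)
    (x : Fin N → Bool) : x ∘ joinEmb e f h = Fin.append (x ∘ e) (x ∘ f) := by
  funext s
  refine Fin.addCases (fun s => ?_) (fun s => ?_) s <;>
    simp [joinEmb_castAdd, joinEmb_natAdd]

lemma joinEmb_ne {a b N : ℕ} {e : Fin a ↪ Fin N} {f : Fin b ↪ Fin N} (h : ∀ s t, e s ≠ f t)
    {q : Fin N} (he : ∀ s, e s ≠ q) (hf : ∀ s, f s ≠ q) (s : Fin (a + b)) :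
    joinEmb e f h s ≠ q := by
  refine Fin.addCases (fun s => ?_) (fun s => ?_) s
  · simpa [joinEmb_castAdd] using he s
  · simpa [joinEmb_natAdd] using hf s

lemma extend_comp_of_disjoint {k k' N : ℕ} (e : Fin k ↪ Fin N) (f : Fin k' → Fin N)
    (h : ∀ s t, e s ≠ f t) (z : Fin k → Bool) (x : Fin N → Bool) :
    Function.extend e z x ∘ f = x ∘ f :=
  funext fun t => extend_of_avoid e z x fun s => h s t

/-- The number of qubits: registers of `a`, `b`, `p` and `b` qubits, one qubit for each of these
qubits, and one more. -/
abbrev total (a b p : ℕ) : ℕ := (a + b) + ((p + b) + ((a + b) + (p + b) + 1))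

/-- The register of the row index. -/
def regI (a b p : ℕ) : Fin a ↪ Fin (total a b p) :=
  (Fin.castAddEmb b).trans (Fin.castAddEmb _)

/-- The register of the column index. -/
def regJ (a b p : ℕ) : Fin b ↪ Fin (total a b p) :=
  (Fin.natAddEmb a).trans (Fin.castAddEmb _)

/-- The register of the summation index. -/
def regM (a b p : ℕ) : Fin p ↪ Fin (total a b p) :=
  ((Fin.castAddEmb b).trans (Fin.castAddEmb _)).trans (Fin.natAddEmb (a + b))

/-- The register of the copy of the column index. -/
def regK (a b p : ℕ) : Fin b ↪ Fin (total a b p) :=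
  ((Fin.natAddEmb p).trans (Fin.castAddEmb _)).trans (Fin.natAddEmb (a + b))

/-- The ancilla qubits. -/
def anc (a b p : ℕ) : Fin ((a + b) + (p + b) + 1) ↪ Fin (total a b p) :=
  (Fin.natAddEmb (p + b)).trans (Fin.natAddEmb (a + b))

/-- All qubits that are not ancillas. -/
def data (a b p : ℕ) : Fin ((a + b) + (p + b)) ↪ Fin (total a b p) :=
  Fin.castLEEmb (by simp only [total]; omega)

section Registers

variable (a b p : ℕ)

lemma regI_val (t) : (regI a b p t).val = t := rfl
lemma regJ_val (t) : (regJ a b p t).val = a + t := rfl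
lemma regM_val (t) : (regM a b p t).val = (a + b) + t := rfl
lemma regK_val (t) : (regK a b p t).val = (a + b) + (p + t) := rfl
lemma anc_val (t) : (anc a b p t).val = (a + b) + ((p + b) + t) := rfl
lemma data_val (t) : (data a b p t).val = t := rfl

lemma regI_ne_regJ (s t) : regI a b p s ≠ regJ a b p t := by
  rw [Ne, Fin.ext_iff, regI_val, regJ_val]; omega
lemma regI_ne_regM (s t) : regI a b p s ≠ regM a b p t := by
  rw [Ne, Fin.ext_iff, regI_val, regM_val]; omega
lemma regI_ne_regK (s t) : regI a b p s ≠ regK a b p t := by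
  rw [Ne, Fin.ext_iff, regI_val, regK_val]; omega
lemma regI_ne_anc (s t) : regI a b p s ≠ anc a b p t := by
  rw [Ne, Fin.ext_iff, regI_val, anc_val]; omega
lemma regJ_ne_regM (s t) : regJ a b p s ≠ regM a b p t := by
  rw [Ne, Fin.ext_iff, regJ_val, regM_val]; omega
lemma regJ_ne_regK (s t) : regJ a b p s ≠ regK a b p t := by
  rw [Ne, Fin.ext_iff, regJ_val, regK_val]; omega
lemma regJ_ne_anc (s t) : regJ a b p s ≠ anc a b p t := by
  rw [Ne, Fin.ext_iff, regJ_val, anc_val]; omega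
lemma regM_ne_regK (s t) : regM a b p s ≠ regK a b p t := by
  rw [Ne, Fin.ext_iff, regM_val, regK_val]; omega
lemma regM_ne_anc (s t) : regM a b p s ≠ anc a b p t := by
  rw [Ne, Fin.ext_iff, regM_val, anc_val]; omega
lemma regK_ne_anc (s t) : regK a b p s ≠ anc a b p t := by
  rw [Ne, Fin.ext_iff, regK_val, anc_val]; omega
lemma data_ne_anc (s t) : data a b p s ≠ anc a b p t := by
  rw [Ne, Fin.ext_iff, data_val, anc_val]; omega

lemma exists_register (q : Fin (total a b p)) :
    (∃ t, q = regI a b p t) ∨ (∃ t, q = regJ a b p t) ∨ (∃ t, q = regM a b p t) ∨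
      (∃ t, q = regK a b p t) ∨ ∃ t, q = anc a b p t := by
  refine Fin.addCases (fun q => ?_) (fun q => ?_) q
  · refine Fin.addCases (fun t => ?_) (fun t => ?_) q
    · exact .inl ⟨t, rfl⟩
    · exact .inr (.inl ⟨t, rfl⟩)
  · refine Fin.addCases (fun q => ?_) (fun t => ?_) q
    · refine Fin.addCases (fun t => ?_) (fun t => ?_) q
      · exact .inr (.inr (.inl ⟨t, rfl⟩))
      · exact .inr (.inr (.inr (.inl ⟨t, rfl⟩)))
    · exact .inr (.inr (.inr (.inr ⟨t, rfl⟩)))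

lemma exists_data_or_anc (q : Fin (total a b p)) :
    (∃ t, q = data a b p t) ∨ ∃ t, q = anc a b p t := by
  by_cases h : q.val < (a + b) + (p + b)
  · exact .inl ⟨⟨q, h⟩, rfl⟩
  · have := q.2
    simp only [total] at this
    refine .inr ⟨⟨q.val - ((a + b) + (p + b)), by omega⟩, Fin.ext ?_⟩
    rw [anc_val]
    simp only
    omega

lemma ketZero_total (x : Fin (total a b p) → Bool) :
    ketZero (total a b p) x = ketZero a (x ∘ regI a b p) * (ketZero b (x ∘ regJ a b p) *
      (ketZero p (x ∘ regM a b p) *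
        (ketZero b (x ∘ regK a b p) * ketZero _ (x ∘ anc a b p)))) := by
  simp only [ketZero_apply, ← ite_and, mul_ite, mul_one, mul_zero]
  congr 1
  simp only [eq_iff_iff, funext_iff, Function.comp_apply]
  constructor
  · intro h
    simp [h]
  · rintro h q
    rcases exists_register a b p q with ⟨t, rfl⟩ | ⟨t, rfl⟩ | ⟨t, rfl⟩ | ⟨t, rfl⟩ | ⟨t, rfl⟩ <;>
      simp [h]

/-- The basis states in which all ancillas vanish. -/
def cleanAnc : Set (Fin (total a b p) → Bool) := {x | ∀ t, x (anc a b p t) = false}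

variable {a b p}

lemma onQubits_preservesSupport {k : ℕ} (e : Fin k ↪ Fin (total a b p))
    (he : ∀ s t, e s ≠ anc a b p t) (U : Matrix (Fin k → Bool) (Fin k → Bool) ℂ) :
    PreservesSupport (cleanAnc a b p) (onQubits e U) := by
  intro ψ hψ x hx
  rw [onQubits_mulVec]
  refine Finset.sum_eq_zero fun z _ => ?_
  rw [hψ, mul_zero]
  intro h
  refine hx fun t => ?_
  rw [← h t, extend_of_avoid e z x fun s => he s t]

/-- A phase on the basis states in which the given data qubits vanish. -/
def reflection {l m n : ℕ} (ω : unitary ℂ) (L : List (Fin ((a + b) + (p + b)))) :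
    Circuit l m n (total a b p) :=
  zeroPhase ω (anc a b p 0) (L.map fun d => (data a b p d, anc a b p d.succ))

lemma length_reflection_le {l m n : ℕ} (ω : unitary ℂ) (L : List (Fin ((a + b) + (p + b)))) :
    List.length (reflection ω L : Circuit l m n (total a b p)) ≤ 10 * L.length + 1 := by
  simpa [reflection] using length_zeroPhase_le (l := l) (m := m) (n := n) ω (anc a b p 0)
    (L.map fun d => (data a b p d, anc a b p d.succ))

/-- Ancilla 0 supplies the initial zero of the OR chain, and data qubit `d` has ancilla `d.succ` as
its target, hence one ancilla more than data qubits. -/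
lemma exists_mat_reflection {l m n : ℕ} (ω : unitary ℂ) {L : List (Fin ((a + b) + (p + b)))}
    (hL : L.Nodup) :
    ∃ ρ : (Fin (total a b p) → Bool) → ℂ,
      (∀ O : OracleFamily l m n, Circuit.mat O (reflection ω L) = Matrix.diagonal ρ) ∧
      ∀ x ∈ cleanAnc a b p, ρ x = if ∀ d ∈ L, x (data a b p d) = false then (ω : ℂ) else 1 := by
  obtain ⟨ρ, h1, h2⟩ := exists_zeroPhase_mulVec (l := l) (m := m) (n := n) ω (anc a b p 0)
    (L.map fun d => (data a b p d, anc a b p d.succ))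
    (by
      simp only [List.forall_mem_map]
      exact fun d _ => ⟨data_ne_anc a b p _ _, (anc a b p).injective.ne (Fin.succ_ne_zero d).symm⟩)
    (by
      simp only [List.forall_mem_map]
      exact fun d _ => data_ne_anc a b p _ _)
    (by
      rw [List.pairwise_map]
      exact hL.imp fun h => ⟨data_ne_anc a b p _ _,
        (anc a b p).injective.ne fun h' => h (Fin.succ_injective _ h')⟩)
  refine ⟨ρ, fun O => ?_, fun x hx => ?_⟩
  · refine Matrix.ext_of_mulVec_single fun y => ?_
    generalize (Pi.single y 1 : State (total a b p)) = ψ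
    rw [reflection, h1]
    funext x
    rw [Matrix.mulVec_diagonal]
  · rw [h2 x (by
      simp only [List.forall_mem_map]
      exact fun d _ => hx d.succ)]
    simp only [hx 0, true_and, List.forall_mem_map]

end Registers

/-! ## The circuit that prepares the product -/

section Prepare

variable (l m n : ℕ)

/-- The registers of the row index and the summation index. -/
def regIM : Fin (qubits l + qubits m) ↪ Fin (total (qubits l) (qubits n) (qubits m)) :=
  joinEmb (regI _ _ _) (regM _ _ _) (regI_ne_regM _ _ _)

/-- The registers of the copy of the column index and the summation index. -/
def regKM : Fin (qubits n + qubits m) ↪ Fin (total (qubits l) (qubits n) (qubits m)) :=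
  joinEmb (regK _ _ _) (regM _ _ _) fun s t => (regM_ne_regK _ _ _ t s).symm

/-- The preparation of the rows of `A` and of the column norms of `B`. -/
def loadCircuit : Circuit l m n (total (qubits l) (qubits n) (qubits m)) :=
  [.query .normA false (regI _ _ _), .query .normB false (regJ _ _ _),
    .query .rowA false (regIM l m n)]

/-- The copy of the column index. -/
def copyCircuit : Circuit l m n (total (qubits l) (qubits n) (qubits m)) :=
  copyBits (regJ _ _ _) (regK _ _ _) (List.finRange (qubits n))

/-- The circuit whose final state has the entries of `A * B` as amplitudes of the basis states in
which the work qubits vanish. -/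
def productCircuit : Circuit l m n (total (qubits l) (qubits n) (qubits m)) :=
  (loadCircuit l m n ++ (copyCircuit l m n ++
    ([.query .colB true (regKM l m n)] ++ copyCircuit l m n : List _) : List _) : List _)

lemma length_productCircuit_le :
    List.length (productCircuit l m n) ≤ 4 + 2 * qubits n := by
  have := length_copyBits_le (l := l) (m := m) (n := n) (regJ (qubits l) (qubits n) (qubits m))
    (regK (qubits l) (qubits n) (qubits m)) (List.finRange (qubits n))
  rw [List.length_finRange] at this
  simp only [productCircuit, loadCircuit, copyCircuit, List.length_append, List.length_cons,
    List.length_nil]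
  omega

variable {l m n}

lemma mat_copyBits_preservesSupport {a b p k : ℕ} (O : OracleFamily l m n)
    (e f : Fin k → Fin (total a b p))
    (he : ∀ s t, e s ≠ anc a b p t) (hf : ∀ s t, f s ≠ anc a b p t) (L : List (Fin k)) :
    PreservesSupport (cleanAnc a b p) (Circuit.mat O (copyBits e f L)) ∧
      PreservesSupport (cleanAnc a b p) (Circuit.mat O (copyBits e f L))ᴴ := by
  have h1 : PreservesSupport (cleanAnc a b p) 1 := fun ψ hψ => by rwa [Matrix.one_mulVec]
  induction L with
  | nil => simpa only [copyBits, Circuit.mat, Matrix.conjTranspose_one, and_self] using h1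
  | cons t L ih =>
    rw [copyBits, Circuit.mat_append, Matrix.conjTranspose_mul]
    have : PreservesSupport (cleanAnc a b p) (Circuit.mat O (cgate notGate (e t) (f t))) ∧
        PreservesSupport (cleanAnc a b p) (Circuit.mat O (cgate notGate (e t) (f t)))ᴴ := by
      unfold cgate
      split_ifs with h
      · have h2 (s u) : pairEmb (e t) (f t) h s ≠ anc a b p u := by
          fin_cases s
          · exact he t u
          · exact hf t u
        simp only [Circuit.mat, Matrix.one_mul, Op.toMatrix, onQubits_conjTranspose]
        exact ⟨onQubits_preservesSupport _ h2 _, onQubits_preservesSupport _ h2 _⟩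
      · simpa only [Circuit.mat, Matrix.conjTranspose_one, and_self] using h1
    exact ⟨ih.1.mul this.1, this.2.mul ih.2⟩

lemma productCircuit_preservesSupport (O : OracleFamily l m n) :
    PreservesSupport (cleanAnc _ _ _) (Circuit.mat O (productCircuit l m n)) ∧
      PreservesSupport (cleanAnc _ _ _) (Circuit.mat O (productCircuit l m n))ᴴ := by
  have h1 := mat_copyBits_preservesSupport O (regJ (qubits l) (qubits n) (qubits m)) (regK _ _ _)
    (regJ_ne_anc _ _ _) (regK_ne_anc _ _ _) (List.finRange (qubits n))
  have h2 (s t) : regIM l m n s ≠ anc _ _ _ t :=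
    joinEmb_ne _ (fun s => regI_ne_anc _ _ _ s t) (fun s => regM_ne_anc _ _ _ s t) s
  have h3 (s t) : regKM l m n s ≠ anc _ _ _ t :=
    joinEmb_ne _ (fun s => regK_ne_anc _ _ _ s t) (fun s => regM_ne_anc _ _ _ s t) s
  simp only [productCircuit, Circuit.mat_append, loadCircuit, Circuit.mat, Op.toMatrix,
    Matrix.conjTranspose_mul, Matrix.one_mul, onQubits_conjTranspose, copyCircuit]
  constructor
  · exact ((h1.1.mul (onQubits_preservesSupport _ h3 _)).mul h1.1).mul
      (((onQubits_preservesSupport _ h2 _).mul (onQubits_preservesSupport _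
        (regJ_ne_anc _ _ _) _)).mul (onQubits_preservesSupport _ (regI_ne_anc _ _ _) _))
  · exact ((onQubits_preservesSupport _ (regI_ne_anc _ _ _) _).mul
      ((onQubits_preservesSupport _ (regJ_ne_anc _ _ _) _).mul
        (onQubits_preservesSupport _ h2 _))).mul
      (h1.2.mul ((onQubits_preservesSupport _ h3 _).mul h1.2))

variable {O : OracleFamily l m n} {A : Matrix (Fin l) (Fin m) ℝ} {B : Matrix (Fin m) (Fin n) ℝ}

/-- The oracle is unconstrained on zero rows, but there the row norm makes the amplitude vanish. -/
lemma Prepares.rowA_mulVec (h : Prepares O A B) :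
    (O .rowA).val *ᵥ (tensor (vecState (rowNorms A)) (ketZero (qubits m)) :
      State (qubits l + qubits m)) = matState A := by
  have e1 : (tensor (vecState (rowNorms A)) (ketZero (qubits m)) : State (qubits l + qubits m))
      = ∑ i, ((vecNorm (A i) / ‖A‖ : ℝ) : ℂ) • tensor (idx i) (ketZero (qubits m)) := by
    funext x
    simp only [tensor, vecState_apply, vecNorm_rowNorms, Finset.sum_apply, Pi.smul_apply,
      smul_eq_mul, Finset.sum_mul, mul_assoc]
    rfl
  rw [e1, Matrix.mulVec_sum, matState]
  refine Finset.sum_congr rfl fun i _ => ?_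
  rw [Matrix.mulVec_smul]
  by_cases hi : A i = 0
  · rw [vecNorm_eq_zero.mpr hi, zero_div, Complex.ofReal_zero, zero_smul]
    simp [hi]
  · rw [h.rowA i hi]
    have h0 : vecNorm (A i) ≠ 0 := mt vecNorm_eq_zero.mp hi
    funext x
    simp only [tensor, vecState_apply, Finset.sum_apply, Pi.smul_apply, smul_eq_mul,
      Finset.mul_sum]
    refine Finset.sum_congr rfl fun k _ => ?_
    rw [show A i k / ‖A‖ = vecNorm (A i) / ‖A‖ * (A i k / vecNorm (A i)) by field_simp]
    push_cast
    ring

lemma loadCircuit_mulVec (h : Prepares O A B) :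
    Circuit.mat O (loadCircuit l m n) *ᵥ ketZero _ = fun x =>
      matState A (Fin.append (x ∘ regI _ _ _) (x ∘ regM _ _ _)) *
        (vecState (colNorms B) (x ∘ regJ _ _ _) * (ketZero _ (x ∘ regK _ _ _) *
          ketZero _ (x ∘ anc _ _ _))) := by
  simp only [loadCircuit, Circuit.mat, Op.toMatrix, oracleMatrix, Bool.false_eq_true, if_false,
    Matrix.one_mul, ← Matrix.mulVec_mulVec]
  rw [show ketZero (total (qubits l) (qubits n) (qubits m)) = _ from funext (ketZero_total _ _ _),
    onQubits_mulVec_product, h.normA]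
  -- Before each further query the product is rearranged so that the factor on the queried registers
  -- stands first, as `onQubits_mulVec_product` requires.
  · rw [show (fun x : Fin (total (qubits l) (qubits n) (qubits m)) → Bool =>
        vecState (rowNorms A) (x ∘ regI _ _ _) * (ketZero _ (x ∘ regJ _ _ _) *
          (ketZero _ (x ∘ regM _ _ _) * (ketZero _ (x ∘ regK _ _ _) *
            ketZero _ (x ∘ anc _ _ _))))) = fun x => ketZero _ (x ∘ regJ _ _ _) *
        (vecState (rowNorms A) (x ∘ regI _ _ _) * (ketZero _ (x ∘ regM _ _ _) *
          (ketZero _ (x ∘ regK _ _ _) * ketZero _ (x ∘ anc _ _ _)))) from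
        funext fun x => by ring, onQubits_mulVec_product, h.normB]
    · rw [show (fun x : Fin (total (qubits l) (qubits n) (qubits m)) → Bool =>
          vecState (colNorms B) (x ∘ regJ _ _ _) *
          (vecState (rowNorms A) (x ∘ regI _ _ _) * (ketZero _ (x ∘ regM _ _ _) *
            (ketZero _ (x ∘ regK _ _ _) * ketZero _ (x ∘ anc _ _ _))))) = fun x =>
          (tensor (vecState (rowNorms A)) (ketZero (qubits m)) : State (qubits l + qubits m))
            (x ∘ regIM l m n) * (vecState (colNorms B) (x ∘ regJ _ _ _) *
              (ketZero _ (x ∘ regK _ _ _) * ketZero _ (x ∘ anc _ _ _))) from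
          funext fun x => by
            rw [regIM, comp_joinEmb, tensor_append]
            ring, onQubits_mulVec_product, h.rowA_mulVec]
      · simp only [regIM, comp_joinEmb]
      · intro z x
        rw [extend_comp_of_disjoint, extend_comp_of_disjoint, extend_comp_of_disjoint]
        · exact fun s t => joinEmb_ne _ (fun s => regI_ne_anc _ _ _ s t)
            (fun s => regM_ne_anc _ _ _ s t) s
        · exact fun s t => joinEmb_ne _ (fun s => regI_ne_regK _ _ _ s t)
            (fun s => regM_ne_regK _ _ _ s t) s
        · exact fun s t => joinEmb_ne _ (fun s => regI_ne_regJ _ _ _ s t)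
            (fun s => (regJ_ne_regM _ _ _ t s).symm) s
    · intro z x
      rw [extend_comp_of_disjoint _ _ (regJ_ne_anc _ _ _),
        extend_comp_of_disjoint _ _ (regJ_ne_regK _ _ _),
        extend_comp_of_disjoint _ _ (regJ_ne_regM _ _ _),
        extend_comp_of_disjoint _ _ fun s t => (regI_ne_regJ _ _ _ t s).symm]
  · intro z x
    rw [extend_comp_of_disjoint _ _ (regI_ne_anc _ _ _),
      extend_comp_of_disjoint _ _ (regI_ne_regK _ _ _),
      extend_comp_of_disjoint _ _ (regI_ne_regM _ _ _),
      extend_comp_of_disjoint _ _ (regI_ne_regJ _ _ _)]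

lemma exists_copyCircuit_mulVec (l m n : ℕ) :
    ∃ σ : (Fin (total (qubits l) (qubits n) (qubits m)) → Bool) →
        Fin (total (qubits l) (qubits n) (qubits m)) → Bool,
      (∀ (O : OracleFamily l m n) (ψ : State _),
        Circuit.mat O (copyCircuit l m n) *ᵥ ψ = fun x => ψ (σ x)) ∧
      (∀ x t, (σ x ∘ regK _ _ _) t = ((x ∘ regK _ _ _) t ^^ (x ∘ regJ _ _ _) t)) ∧
      (∀ x, σ x ∘ regI _ _ _ = x ∘ regI _ _ _) ∧ (∀ x, σ x ∘ regJ _ _ _ = x ∘ regJ _ _ _) ∧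
      (∀ x, σ x ∘ regM _ _ _ = x ∘ regM _ _ _) ∧ ∀ x, σ x ∘ anc _ _ _ = x ∘ anc _ _ _ := by
  obtain ⟨σ, h1, h2, h3⟩ := exists_copyBits_mulVec (l := l) (m := m) (n := n)
    (regJ (qubits l) (qubits n) (qubits m)) (regK _ _ _) (regK _ _ _).injective
    (regJ_ne_regK _ _ _) (List.finRange (qubits n)) (List.nodup_finRange _)
  refine ⟨σ, h1, fun x t => ?_, fun x => funext fun t => ?_, fun x => funext fun t => ?_,
    fun x => funext fun t => ?_, fun x => funext fun t => ?_⟩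
  · simp [h2]
  · exact h3 x _ fun s => regI_ne_regK _ _ _ t s
  · exact h3 x _ fun s => regJ_ne_regK _ _ _ t s
  · exact h3 x _ fun s => regM_ne_regK _ _ _ t s
  · exact h3 x _ fun s => (regK_ne_anc _ _ _ s t).symm

/-- The amplitude that the inverse of the column preparation of `B` reads off. -/
lemma Prepares.sum_colB (h : Prepares O A B) (u : Fin (qubits l) → Bool)
    (v : Fin (qubits n) → Bool) :
    ∑ y : Fin (qubits n) → Bool, ∑ z : Fin (qubits m) → Bool,
      oracleMatrix O .colB true (Fin.append v fun _ => false) (Fin.append y z) *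
        (matState A (Fin.append u z) * (vecState (colNorms B) v * if y = v then 1 else 0))
      = ((‖A * B‖ / (‖A‖ * ‖B‖) : ℝ) : ℂ) * matState (A * B) (Fin.append u v) := by
  by_cases hv : ∃ j, v = bits j
  swap
  · push Not at hv
    rw [matState_append_of_notMem _ _ hv, vecState_of_notMem _ hv]
    simp
  obtain ⟨j, rfl⟩ := hv
  have hAB : ((‖A * B‖ / (‖A‖ * ‖B‖) : ℝ) : ℂ) * matState (A * B) (Fin.append u (bits j))
      = ∑ i, (((A * B) i j / (‖A‖ * ‖B‖) : ℝ) : ℂ) * idx i u := by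
    rw [matState_append_bits, Finset.mul_sum]
    refine Finset.sum_congr rfl fun i _ => ?_
    rw [← mul_assoc, ← Complex.ofReal_mul]
    congr 2
    by_cases h0 : A * B = 0
    · simp [h0]
    · have := norm_ne_zero_iff.mpr h0
      field_simp
  rw [hAB, vecState_bits, vecNorm_colNorms]
  -- For a zero column the oracle is unconstrained, yet the column norm of the index kept in the
  -- register J makes every term vanish.
  by_cases hj : Bᵀ j = 0
  · have h1 : colNorms B j = 0 := vecNorm_eq_zero.mpr hj
    have h2 (i) : (A * B) i j = 0 := by
      rw [Matrix.mul_apply]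
      refine Finset.sum_eq_zero fun k _ => ?_
      rw [show B k j = 0 from congrFun hj k, mul_zero]
    simp [h1, h2]
  have hN : colNorms B j ≠ 0 := mt vecNorm_eq_zero.mp hj
  -- The adjoint is needed only in the row of |j⟩|0⟩, and that row is the conjugate of the prepared
  -- state |j⟩|Bⱼ⟩, which is real. The behaviour of the oracle on other inputs plays no role.
  have hcol (y z) : oracleMatrix O .colB true (Fin.append (bits j) fun _ => false)
      (Fin.append y z) = idx j y * vecState (Bᵀ j) z := by
    have e := congrFun (h.colB j hj) (Fin.append y z)
    rw [tensor_append, show (tensor (idx j) (ketZero (qubits m)) : State (qubits n + qubits m))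
      = Pi.single (Fin.append (bits j) fun _ => false) 1 from ?_, Matrix.mulVec_single_one] at e
    · rw [show oracleMatrix O .colB true = (O .colB).valᴴ from rfl, Matrix.conjTranspose_apply]
      rw [show (O .colB).val (Fin.append y z) (Fin.append (bits j) fun _ => false) = _ from e,
        star_mul', star_vecState]
      congr 1
      rw [idx_apply]
      split_ifs <;> simp
    · funext x
      obtain ⟨⟨y, z⟩, rfl⟩ := (Fin.appendEquiv (qubits n) (qubits m)).surjective x
      change tensor _ _ (Fin.append y z) = (Pi.single _ 1 : State _) (Fin.append y z)
      have happ : (Fin.append y z = Fin.append (bits j) fun _ => false) ↔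
          y = bits j ∧ z = fun _ => false := by
        rw [← Prod.mk.injEq]
        exact (Fin.appendEquiv _ _).injective.eq_iff (a := (y, z)) (b := (bits j, fun _ => false))
      rw [tensor_append, idx_apply, ketZero_apply, Pi.single_apply, if_congr happ rfl rfl]
      split_ifs <;> simp_all
  simp only [hcol]
  rw [Finset.sum_eq_single (bits j)]
  · simp only [idx_apply j, if_true, one_mul, mul_one]
    rw [sum_vecState_mul]
    simp only [matState_append_bits, Finset.sum_mul, Finset.mul_sum]
    rw [Finset.sum_comm]
    refine Finset.sum_congr rfl fun i _ => ?_
    rw [Matrix.mul_apply, Finset.sum_div, Complex.ofReal_sum, Finset.sum_mul]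
    refine Finset.sum_congr rfl fun k _ => ?_
    have hN' : vecNorm (Bᵀ j) ≠ 0 := hN
    have e : A i k * B k j / (‖A‖ * ‖B‖)
        = (Bᵀ j k / vecNorm (Bᵀ j)) * ((A i k / ‖A‖) * (colNorms B j / ‖B‖)) := by
      rw [show colNorms B j = vecNorm (Bᵀ j) from rfl, Matrix.transpose_apply]
      field_simp
    rw [e]
    push_cast
    ring
  · intro y _ hy
    simp [hy]
  · simp

/-- Pulled back through the second copy, K = 0 becomes K = v, the column index in J. Pulled back
through the first, K = y becomes y xor v, which must vanish; this is the indicator `y = v` in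
`Prepares.sum_colB`. -/
lemma productCircuit_mulVec_append (h : Prepares O A B)
    (y : Fin (qubits l + qubits n) → Bool) :
    (Circuit.mat O (productCircuit l m n) *ᵥ ketZero _) (Fin.append y fun _ => false)
      = ((‖A * B‖ / (‖A‖ * ‖B‖) : ℝ) : ℂ) * matState (A * B) y := by
  obtain ⟨σ, h1, hK, hI, hJ, hM, hA⟩ := exists_copyCircuit_mulVec l m n
  obtain ⟨⟨u, v⟩, rfl⟩ := (Fin.appendEquiv (qubits l) (qubits n)).surjective y
  change _ = _ * matState (A * B) (Fin.append u v)
  rw [← h.sum_colB]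
  simp only [productCircuit, Circuit.mat_append, ← Matrix.mulVec_mulVec]
  rw [h1, h1, loadCircuit_mulVec h]
  simp only [Circuit.mat, Matrix.one_mul, Op.toMatrix]
  set x : Fin (total (qubits l) (qubits n) (qubits m)) → Bool :=
    Fin.append (Fin.appendEquiv (qubits l) (qubits n) (u, v)) fun _ => false with hx
  have xI : x ∘ regI _ _ _ = u := by
    funext t
    simp [hx, regI, Fin.appendEquiv]
  have xJ : x ∘ regJ _ _ _ = v := by
    funext t
    simp [hx, regJ, Fin.appendEquiv]
  have xM : x ∘ regM _ _ _ = fun _ => false := by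
    funext t
    simp [hx, regM]
  have xK : x ∘ regK _ _ _ = fun _ => false := by
    funext t
    simp [hx, regK]
  have xA : x ∘ anc _ _ _ = fun _ => false := by
    funext t
    simp [hx, anc]
  have sK : σ x ∘ regK _ _ _ = v := by
    funext t
    rw [hK, xK, xJ, Bool.false_xor]
  have e0 : σ x ∘ regKM l m n = Fin.append v fun _ => false := by
    rw [regKM, comp_joinEmb, sK, hM, xM]
  rw [onQubits_mulVec, sum_append, e0]
  refine Finset.sum_congr rfl fun y _ => Finset.sum_congr rfl fun z _ => ?_
  congr 1
  set w := Function.extend (regKM l m n) (Fin.append y z) (σ x) with hw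
  have wKM : Fin.append (w ∘ regK _ _ _) (w ∘ regM _ _ _) = Fin.append y z := by
    rw [← comp_joinEmb _ _ fun s t => (regM_ne_regK _ _ _ t s).symm]
    exact extend_comp_emb (regKM l m n) _ _
  have wK : w ∘ regK _ _ _ = y := by
    funext t
    simpa using congrFun wKM (Fin.castAdd _ t)
  have wM : w ∘ regM _ _ _ = z := by
    funext t
    simpa using congrFun wKM (Fin.natAdd _ t)
  have wI : w ∘ regI _ _ _ = u := by
    rw [hw, extend_comp_of_disjoint, hI, xI]
    exact fun s t => joinEmb_ne _ (fun s => (regI_ne_regK _ _ _ t s).symm)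
      (fun s => (regI_ne_regM _ _ _ t s).symm) s
  have wJ : w ∘ regJ _ _ _ = v := by
    rw [hw, extend_comp_of_disjoint, hJ, xJ]
    exact fun s t => joinEmb_ne _ (fun s => (regJ_ne_regK _ _ _ t s).symm)
      (fun s => (regJ_ne_regM _ _ _ t s).symm) s
  have wA : w ∘ anc _ _ _ = fun _ => false := by
    rw [hw, extend_comp_of_disjoint, hA, xA]
    exact fun s t => joinEmb_ne _ (fun s => regK_ne_anc _ _ _ s t)
      (fun s => regM_ne_anc _ _ _ s t) s
  rw [hI, hM, hJ, hA, wI, wM, wJ, wA, ketZero_apply, ketZero_apply, if_pos rfl, mul_one]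
  congr 3
  rw [eq_iff_iff, funext_iff, funext_iff]
  refine forall_congr' fun t => ?_
  rw [hK, wK, wJ]
  cases y t <;> cases v t <;> simp

end Prepare

/-! ## The running time and the accuracy -/

/-- The phase `exp (i π / 3)`. -/
def piThird : unitary ℂ :=
  ⟨⟨1 / 2, √3 / 2⟩, by
    have h : √3 * √3 = 3 := Real.mul_self_sqrt (by norm_num)
    rw [Unitary.mem_iff]
    constructor <;> apply Complex.ext <;> simp <;> linarith⟩

lemma piThird_sq : (piThird : ℂ) ^ 2 = piThird - 1 := by
  have h : √3 * √3 = 3 := Real.mul_self_sqrt (by norm_num)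
  rw [sq]
  apply Complex.ext <;> simp [piThird] <;> linarith

lemma norm_piThird : ‖(piThird : ℂ)‖ = 1 := CStarRing.norm_coe_unitary piThird

lemma qubits_le {d : ℕ} (hd : 0 < d) : (qubits d : ℝ) ≤ 1 + 2 * Real.log d := by
  have h1 : (1 : ℝ) ≤ d := by exact_mod_cast hd
  have h0 : 0 ≤ Real.log d := Real.log_nonneg h1
  rcases Nat.eq_or_lt_of_le (Nat.succ_le_of_lt hd) with h | h
  · rw [← h]
    simp
  · have h2 : (2 : ℝ) ^ (Nat.clog 2 d).pred ≤ d := by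
      exact_mod_cast (Nat.pow_pred_clog_lt_self one_lt_two h).le
    have h3 := Real.log_le_log (by positivity) h2
    rw [Real.log_pow] at h3
    have h4 : (qubits d : ℝ) ≤ (Nat.clog 2 d).pred + 1 := by
      exact_mod_cast Nat.le_succ_of_pred_le le_rfl
    have h5 := Real.log_two_gt_d9
    have h6 : (0 : ℝ) ≤ (Nat.clog 2 d).pred := Nat.cast_nonneg _
    nlinarith

/-- Write P = lmn and X for the argument of the logarithm. The left side is at most 4 + 2 log P.
Here log P ≤ 2 log X, and 4 ≤ 8 log X since log X ≥ log 2 > 1/2; together this gives 12. -/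
lemma qubits_add_le {l m n : ℕ} (hl : 0 < l) (hm : 0 < m) (hn : 0 < n) {ε R : ℝ} (hε : 0 < ε)
    (hε2 : ε < 2) (hR : 1 ≤ R) :
    1 + (qubits l : ℝ) + qubits m + qubits n ≤ 12 * Real.log (2 + l * m * n * R / ε) := by
  have hl' : (0 : ℝ) < l := by exact_mod_cast hl
  have hm' : (0 : ℝ) < m := by exact_mod_cast hm
  have hn' : (0 : ℝ) < n := by exact_mod_cast hn
  set P : ℝ := l * m * n with hP
  have hP0 : 0 < P := by positivity
  have hY : P / 2 ≤ P * R / ε := by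
    rw [le_div_iff₀ hε]
    nlinarith
  have hX : Real.log 2 ≤ Real.log (2 + P * R / ε) := Real.log_le_log two_pos (by linarith)
  have hPX : Real.log P ≤ 2 * Real.log (2 + P * R / ε) := by
    rw [show (2 : ℝ) * Real.log (2 + P * R / ε) = Real.log ((2 + P * R / ε) ^ 2) by
      rw [Real.log_pow]; norm_num]
    exact Real.log_le_log hP0 (by nlinarith)
  have hlog : Real.log P = Real.log l + Real.log m + Real.log n := by
    rw [hP, Real.log_mul (by positivity) hn'.ne', Real.log_mul hl'.ne' hm'.ne']
  have := qubits_le hl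
  have := qubits_le hm
  have := qubits_le hn
  have := Real.log_two_gt_d9
  linarith

/-- The power is at most exp(-s²M) = exp(u)⁻² with u = s²M/2 ≥ 3/(2ε). The crude bound exp u ≥ u
already gives 2 · (4/9) ε² ≤ ε², so the number of rounds can be chosen without logarithms. -/
lemma two_mul_one_sub_sq_pow_le {s R ε : ℝ} {M : ℕ} (hs1 : 0 ≤ 1 - s ^ 2) (hR : 0 < R)
    (hs : 1 / R ≤ s) (hε : 0 < ε) (hM : 3 * R ^ 2 / ε ≤ M) : 2 * (1 - s ^ 2) ^ M ≤ ε ^ 2 := by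
  set u : ℝ := s ^ 2 * M / 2 with hu
  have hu1 : 3 / (2 * ε) ≤ u := by
    have h1 : (1 / R) ^ 2 ≤ s ^ 2 := pow_le_pow_left₀ (by positivity) hs 2
    have h2 : (1 / R) ^ 2 * (3 * R ^ 2 / ε) ≤ s ^ 2 * M :=
      mul_le_mul h1 hM (by positivity) (by positivity)
    rw [show (1 / R) ^ 2 * (3 * R ^ 2 / ε) = 2 * (3 / (2 * ε)) by field_simp] at h2
    linarith
  have hu0 : 0 < u := lt_of_lt_of_le (by positivity) hu1
  have h3 : (1 - s ^ 2) ^ M ≤ (Real.exp u ^ 2)⁻¹ := by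
    calc (1 - s ^ 2) ^ M ≤ Real.exp (-s ^ 2) ^ M :=
          pow_le_pow_left₀ hs1 (Real.one_sub_le_exp_neg _) M
      _ = (Real.exp u ^ 2)⁻¹ := by
          rw [← Real.exp_nat_mul, ← Real.exp_nat_mul, ← Real.exp_neg]
          congr 1
          rw [hu]
          push_cast
          ring
  have h4 : 3 / (2 * ε) ≤ Real.exp u := hu1.trans (by linarith [Real.add_one_le_exp u])
  have h5 : (Real.exp u ^ 2)⁻¹ ≤ ((3 / (2 * ε)) ^ 2)⁻¹ :=
    inv_anti₀ (by positivity) (pow_le_pow_left₀ (by positivity) h4 2)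
  have h6 : ((3 / (2 * ε)) ^ 2)⁻¹ = 4 / 9 * ε ^ 2 := by
    field_simp
    norm_num
  nlinarith [sq_nonneg ε]

/-- The product circuit, amplified `k` times. -/
def mainCircuit (l m n k : ℕ) : Circuit l m n (total (qubits l) (qubits n) (qubits m)) :=
  amplify (productCircuit l m n) (reflection piThird (List.finRange _))
    (reflection piThird ((List.finRange _).map (Fin.natAdd _))) k

/-- The column index needs the largest coefficient: 2 for the two copies, 20 for the initial
reflection, which tests J and K, and 10 for the target reflection, which tests K. This is the 32. -/
lemma length_mainCircuit_le (l m n k : ℕ) :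
    List.length (mainCircuit l m n k) ≤ 3 ^ k * (32 * (1 + qubits l + qubits m + qubits n)) := by
  have h1 := length_amplify_le (productCircuit l m n) (reflection piThird (List.finRange _))
    (reflection piThird ((List.finRange _).map (Fin.natAdd _))) k
  have h2 := length_productCircuit_le l m n
  have h3 := length_reflection_le (l := l) (m := m) (n := n) (a := qubits l) (b := qubits n)
    (p := qubits m) piThird (List.finRange _)
  have h4 := length_reflection_le (l := l) (m := m) (n := n) (a := qubits l) (b := qubits n)
    (p := qubits m) piThird ((List.finRange _).map (Fin.natAdd _))
  rw [List.length_finRange] at h3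
  rw [List.length_map, List.length_finRange] at h4
  refine le_trans (le_trans (by rw [mainCircuit]; omega) h1) (Nat.mul_le_mul_left _ ?_)
  omega

/-- The bound on `k` involves only R and ε: the fixed-point recursion cannot overshoot, so a larger
s does no harm and one circuit serves all admissible inputs. -/
lemma mainCircuit_obtains {l m n k : ℕ} {ε R : ℝ} (hε : 0 < ε) (hR : 1 ≤ R)
    (hk : 3 * R ^ 2 / ε ≤ 3 ^ k) {A : Matrix (Fin l) (Fin m) ℝ} {B : Matrix (Fin m) (Fin n) ℝ}
    {O : OracleFamily l m n} (hAB : A * B ≠ 0) (hABR : ‖A‖ * ‖B‖ / ‖A * B‖ ≤ R)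
    (h : Prepares O A B) : (mainCircuit l m n k).Obtains O (matState (A * B)) ε := by
  have hA : A ≠ 0 := by
    rintro rfl
    simp at hAB
  have hB : B ≠ 0 := by
    rintro rfl
    simp at hAB
  have hA' := norm_pos_iff.mpr hA
  have hB' := norm_pos_iff.mpr hB
  have hAB' := norm_pos_iff.mpr hAB
  set s : ℝ := ‖A * B‖ / (‖A‖ * ‖B‖) with hs
  have hs0 : 0 < s := by positivity
  have hsR : 1 / R ≤ s := by
    rw [hs, one_div_le (by positivity) (by positivity), one_div_div]
    exact hABR
  obtain ⟨ρs, hρs, hρs'⟩ := exists_mat_reflection (l := l) (m := m) (n := n) (a := qubits l)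
    (b := qubits n) (p := qubits m) piThird (List.nodup_finRange _)
  obtain ⟨ρt, hρt, hρt'⟩ := exists_mat_reflection (l := l) (m := m) (n := n) (a := qubits l)
    (b := qubits n) (p := qubits m) piThird
    ((List.nodup_finRange _).map (Fin.natAdd_injective _ _))
  -- All work qubits vanish exactly when the ancillas and the registers M and K do. On clean
  -- ancillas the target reflection therefore has to test only M and K.
  have hT (x : Fin (total (qubits l) (qubits n) (qubits m)) → Bool) :
      x ∈ {x | ∀ t, x (Fin.natAdd (qubits l + qubits n) t) = false} ↔ x ∈ cleanAnc _ _ _ ∧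
        ∀ d ∈ (List.finRange (qubits m + qubits n)).map (Fin.natAdd (qubits l + qubits n)),
          x (data _ _ _ d) = false := by
    simp only [List.forall_mem_map, List.mem_finRange, forall_const]
    constructor
    · intro hx
      exact ⟨fun t => hx (Fin.natAdd _ t), fun d => hx (Fin.castAdd _ d)⟩
    · rintro ⟨h1, h2⟩ t
      exact Fin.addCases (fun d => h2 d) (fun d => h1 d) t
  obtain ⟨c, hc, hδ⟩ := exists_amplify_mulVec O (T := {x | ∀ t, x (Fin.natAdd _ t) = false})
    piThird_sq norm_piThird (productCircuit_preservesSupport O).1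
    (productCircuit_preservesSupport O).2 (fun _ => rfl) (hρs O) (hρt O)
    (fun x hx hx0 => by rw [hρs' x hx, if_pos fun d _ => by rw [hx0]])
    (fun x hx hx0 => by
      rw [hρs' x hx, if_neg]
      intro hd
      refine hx0 (funext fun q => ?_)
      rcases exists_data_or_anc _ _ _ q with ⟨t, rfl⟩ | ⟨t, rfl⟩
      · exact hd t (List.mem_finRange t)
      · exact hx t)
    (fun x hx => by
      obtain ⟨h1, h2⟩ := (hT x).mp hx
      rw [hρt' x h1, if_pos h2])
    (fun x hx hxT => by rw [hρt' x hx, if_neg fun h2 => hxT ((hT x).mpr ⟨hx, h2⟩)]) k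
  have hψ0 := State.norm_sq_mulVec_ketZero (Circuit.mat_mem_unitaryGroup O (productCircuit l m n))
  have hψ := State.norm_sq_mulVec_ketZero (Circuit.mat_mem_unitaryGroup O (mainCircuit l m n k))
  have hφ := sum_norm_sq_matState hAB
  have hck (y) : (Circuit.mat O (mainCircuit l m n k) *ᵥ ketZero _) (Fin.append y fun _ => false)
      = (c * (s : ℂ)) * matState (A * B) y := by
    rw [mul_assoc, ← productCircuit_mulVec_append h y]
    exact hc _ fun t => by rw [Fin.append_right]
  have e0 := sum_indicator_compl_norm_sq hψ0 hφ (productCircuit_mulVec_append h)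
  have ek := sum_indicator_compl_norm_sq hψ hφ hck
  rw [Complex.norm_real, Real.norm_of_nonneg hs0.le] at e0
  rw [e0] at hδ
  have hs1 : 0 ≤ 1 - s ^ 2 := by
    rw [← e0]
    exact Finset.sum_nonneg fun x _ => Set.indicator_nonneg (fun _ _ => sq_nonneg _) _
  rw [Circuit.Obtains, Circuit.run_eq]
  refine exists_norm_sub_tensor_le hψ hφ hε.le hck ?_
  rw [ek.symm.trans hδ]
  exact two_mul_one_sub_sq_pow_le hs1 (by positivity) hsR hε (by exact_mod_cast hk)

/-- Two unit vectors are at distance at most 2, so at this accuracy any state will do. -/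
lemma nil_obtains {l m n : ℕ} {ε : ℝ} (hε : 2 ≤ ε) {O : OracleFamily l m n}
    {M : Matrix (Fin l) (Fin n) ℝ} (hM : M ≠ 0) :
    Circuit.Obtains (w := 0) [] O (matState M) ε := by
  have norm_one {N : ℕ} {ψ : State N} (h : ∑ x, ‖ψ x‖ ^ 2 = 1) : State.norm ψ = 1 := by
    rw [← State.norm_sq] at h
    exact (pow_eq_one_iff_of_nonneg (norm_nonneg _) two_ne_zero).mp h
  refine ⟨ketZero 0, norm_one (sum_norm_sq_ketZero 0), ?_⟩
  have h1 := norm_one (sum_norm_sq_ketZero (qubits l + qubits n + 0))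
  have h2 : State.norm (tensor (matState M) (ketZero 0)) = 1 :=
    norm_one (by rw [sum_norm_sq_tensor, sum_norm_sq_matState hM, sum_norm_sq_ketZero, one_mul])
  refine le_trans (norm_sub_le (WithLp.toLp 2 _) (WithLp.toLp 2 _)) ?_
  change State.norm (ketZero _) + State.norm (tensor _ _) ≤ ε
  rw [h1, h2]
  linarith

end QMatMul
end

open QMatMul in
theorem mainTheorem4 :
    ∃ K c : ℕ, ∀ (l m n : ℕ) (ε R : ℝ), 0 < ε → 1 ≤ R →
      ∃ (w : ℕ) (Q : Circuit l m n ((qubits l + qubits n) + w)),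
        (Q.time : ℝ) ≤ K * (R ^ 3 / ε) * Real.log (2 + l * m * n * R / ε) ^ c ∧
        ∀ (A : Matrix (Fin l) (Fin m) ℝ) (B : Matrix (Fin m) (Fin n) ℝ)
          (O : OracleFamily l m n),
          A * B ≠ 0 → ‖A‖ * ‖B‖ / ‖A * B‖ ≤ R → Prepares O A B →
          Q.Obtains O (matState (A * B)) ε := by
  -- 3456 = 9 · 32 · 12: rounds, operations per round and qubit, and qubits against the logarithm.
  refine ⟨3456, 1, fun l m n ε R hε hR => ?_⟩
  by_cases h : (0 < l ∧ 0 < m ∧ 0 < n) ∧ ε < 2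
  · obtain ⟨⟨hl, hm, hn⟩, hε2⟩ := h
    -- The target 3R²/ε lies between 3^k and 3^(k+1); ε < 2 ensures that it is at least 1. Using k +
    -- 1 levels overshoots it by a factor of at most 3, which gives 9R²/ε.
    obtain ⟨k, hk, hk'⟩ := exists_nat_pow_near (x := 3 * R ^ 2 / ε) (y := 3)
      (by rw [one_le_div hε]; nlinarith) (by norm_num)
    refine ⟨_, mainCircuit l m n (k + 1), ?_, fun A B O hAB hABR hO =>
      mainCircuit_obtains hε hR hk'.le hAB hABR hO⟩
    have h1 : ((mainCircuit l m n (k + 1)).time : ℝ)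
        ≤ 3 ^ (k + 1) * (32 * (1 + qubits l + qubits m + qubits n)) := by
      exact_mod_cast length_mainCircuit_le l m n (k + 1)
    have h2 : (3 : ℝ) ^ (k + 1) ≤ 9 * (R ^ 3 / ε) := by
      -- Fixed-point amplification costs only R²/ε here; R ≥ 1 weakens this to the claimed R³/ε.
      have h3 : R ^ 2 / ε ≤ R ^ 3 / ε :=
        div_le_div_of_nonneg_right (pow_le_pow_right₀ hR (by norm_num)) hε.le
      rw [pow_succ]
      rw [mul_div_assoc] at hk
      linarith
    have h4 := qubits_add_le hl hm hn hε hε2 hR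
    calc ((mainCircuit l m n (k + 1)).time : ℝ)
        ≤ 3 ^ (k + 1) * (32 * (1 + qubits l + qubits m + qubits n)) := h1
      _ ≤ (9 * (R ^ 3 / ε)) * (32 * (12 * Real.log (2 + l * m * n * R / ε))) := by gcongr
      _ = (3456 : ℕ) * (R ^ 3 / ε) * Real.log (2 + l * m * n * R / ε) ^ 1 := by
        push_cast
        ring
  -- The empty circuit suffices: if some dimension is zero then `A * B` is zero and the claim is
  -- vacuous, and otherwise ε ≥ 2.
  · refine ⟨0, [], ?_, fun A B O hAB _ _ => nil_obtains ?_ hAB⟩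
    · have h1 : 0 ≤ Real.log (2 + l * m * n * R / ε) :=
        Real.log_nonneg (by linarith [show (0 : ℝ) ≤ l * m * n * R / ε by positivity])
      rw [show Circuit.time ([] : Circuit l m n ((qubits l + qubits n) + 0)) = 0 from rfl,
        Nat.cast_zero]
      positivity
    · by_contra! hε2
      refine h ⟨⟨?_, ?_, ?_⟩, hε2⟩ <;> refine Nat.pos_of_ne_zero ?_ <;> rintro rfl <;>
        refine hAB (Matrix.ext fun i j => ?_)
      · exact i.elim0
      · simp [Matrix.mul_apply]
      · exact j.elim0
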